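/- **Setting.** Identify $\mathbf C^4$ with $\mathbf H^2$ by $(z_1,z_2,z_3,z_4)\mapsto(z_1+jz_2,\,z_3+jz_4)$, where $zj=j\bar z$ and scalars act on the right, and write $\langle v,w\rangle=\bar v_1w_1+\bar v_2w_2$ for the quaternionic product. For a complex line $\ell\subset\mathbf C^4$ put $T_\ell=\mathrm{Hom}(\ell,\ell^\perp)=\mathcal H_\ell\oplus\mathcal V_\ell$, where $\mathcal H_\ell=\mathrm{Hom}(\ell,(\ell\mathbf H)^\perp)$ and $\mathcal V_\ell=\mathrm{Hom}(\ell,\ell j)$ are the horizontal and vertical spaces of the twistor fibration $\ell\mapsto\ell\mathbf H$. The Kähler $\mathbb{CP}^3$ is the space of lines $\ell$ with the usual complex structure $A\mapsto iA$ on $T_\ell$; we then write $\mathbb H,\mathbb V$ for $\mathcal H,\mathcal V$. The nearly Kähler $\mathbf{CP}^3$ is the same manifold with the almost complex structure that is $i$ on $\mathcal H$ and $-i$ on $\mathcal V$. The contact system $\mathbb V^*$ on $\mathbb{CP}^3$ consists of the complex linear forms on the tangent spaces that vanish on $\mathbb H$. The flag manifold $\mathbf{Fl}$ is the space of pairs of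 complex lines $([e_1],[e_2])$ with $\langle e_1,e_2\rangle=0$; let $\Pi_a([e_1],[e_2])=[e_a]$. For a line $S\subset\mathcal H_\ell$ the quotient $\mathcal H_\ell/S$ is identified with the orthogonal complement of $S$ in $\mathcal H_\ell$, and $(\mathcal H_\ell/S)\otimes\ell$ is the line in $\mathbf C^4$ spanned by the values of the homomorphisms in this complement. Let $M$ be a connected Riemann surface. *Null-torsion curves.* A pseudoholomorphic curve is a nonconstant smooth map $X:M\to\mathbf{CP}^3$ whose differential commutes with the almost complex structures. Let $\mathbf I_1$ be the horizontal part of $dX$. The curve $X$ is *null-torsion* if $\mathbf I_1\not\equiv0$ and $\mathbf{II}\equiv0$, where $\mathbf{II}$ is defined through a smooth complex line bundle $L\subset X^*\mathcal H$ in which $\mathbf I_1$ takes its values: for every local smooth frame $e_1,e_2:U\to\mathbf H^2$ with $\langle e_a,e_b\rangle=\delta_{ab}$, $X=[e_1]$ and $e_1^*\otimes e_2j\in L$, the form $\kappa_{1\bar2}=-\bar\tau$ vanishes, where $\tau$ is the $j$-component of $\langle e_2,de_2\rangle=i\rho_2+j\tau$. Put $N_X=X^*\mathcal H/L$. *Integral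 curves.* A nonconstant holomorphic integral of $\mathbb V^*$ is a nonconstant holomorphic map $Y:M\to\mathbb{CP}^3$ on whose differential all forms in $\mathbb V^*$ vanish. **Theorem.** For every null-torsion curve $X$ the line bundle $L$ with $\mathbf I_1\in L$ is unique. For every nonconstant holomorphic integral $Y$ of $\mathbb V^*$ there is a unique smooth complex line bundle $\mathcal L\subset Y^*\mathbb H$ that contains the image of $dY$. Moreover, $\hat X(x)=(X(x),\,N_X(x)\otimes X(x))$ defines a map $\hat X:M\to\mathbf{Fl}$, and the assignment $$X\longmapsto Y=\Pi_2\circ\hat X$$ is a bijection from the set of null-torsion pseudoholomorphic curves $X:M\to\mathbf{CP}^3$ onto the set of nonconstant holomorphic integrals $Y:M\to\mathbb{CP}^3$ of the contact system $\mathbb V^*$. Its inverse is $Y\mapsto X=\Pi_1\circ\hat Y$, where $\hat Y:M\to\mathbf{Fl}$ is the map $\hat Y(x)=\big((\mathbb H/\mathcal L)(x)\otimes Y(x),\,Y(x)\big)$. -/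

import Mathlib

open scoped Manifold ContDiff InnerProductSpace

noncomputable section

namespace NearlyKahler

/-! ### Quaternionic linear algebra on `ℂ⁴ = ℍ²` -/

/-- `ℂ⁴` with its standard Hermitian product (conjugate linear in the first variable). It is
identified with `ℍ²` by `(z₀, z₁, z₂, z₃) ↦ (z₀ + j z₁, z₂ + j z₃)`, where `z j = j z̄`, and `ℂ`
and `ℍ` act on `ℍ²` from the right. -/
abbrev C4 : Type := EuclideanSpace ℂ (Fin 4)

/-- Right multiplication by the quaternion `j` on `ℂ⁴ = ℍ²`: since
`(z + j w) j = - w̄ + j z̄`, it sends `(z₀, z₁, z₂, z₃)` to `(-z̄₁, z̄₀, -z̄₃, z̄₂)`. -/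
def jMul : C4 →ₛₗ[starRingEnd ℂ] C4 where
  toFun v := !₂[-(starRingEnd ℂ (v 1)), starRingEnd ℂ (v 0),
    -(starRingEnd ℂ (v 3)), starRingEnd ℂ (v 2)]
  map_add' v w := by
    ext i; fin_cases i <;> simp [add_comm]
  map_smul' c v := by
    ext i; fin_cases i <;> simp

/-- The vectors `v, w` are orthogonal for the quaternionic product
`⟨v, w⟩ = ⟪v, w⟫ + j ⟪v j, w⟫` of `ℍ²`. -/
def QuatOrthogonal (v w : C4) : Prop :=
  ⟪v, w⟫_ℂ = 0 ∧ ⟪jMul v, w⟫_ℂ = 0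

/-- The set of complex lines in `ℂ⁴`. It carries two almost complex structures below: the usual
one (Kähler) and the nearly Kähler one. -/
abbrev CP3 : Type := Projectivization ℂ C4

/-- The quaternionic line `ℓ ℍ = ℓ ⊕ ℓ j` spanned by the complex line `ℓ`; `ℓ ↦ ℓ ℍ` is the
twistor fibration `ℂP³ → ℍP¹`. -/
def quatLine (ℓ : CP3) : Submodule ℂ C4 :=
  ℓ.submodule ⊔ Submodule.span ℂ (jMul '' (ℓ.submodule : Set C4))

/-! ### The tangent bundle of `ℂP³` and its two almost complex structures -/

/-- The tangent space of `ℂP³` at `ℓ`, that is `Hom(ℓ, ℂ⁴/ℓ) = Hom(ℓ, ℓᗮ)`. -/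
abbrev TangentAt (ℓ : CP3) : Type := ℓ.submodule →ₗ[ℂ] (ℓ.submoduleᗮ : Submodule ℂ C4)

/-- The horizontal space of the twistor fibration: homomorphisms with values in `(ℓ ℍ)ᗮ`. -/
def horizontalSpace (ℓ : CP3) : Submodule ℂ (TangentAt ℓ) where
  carrier := {A | ∀ v, (A v : C4) ∈ (quatLine ℓ)ᗮ}
  add_mem' hA hB v := by simpa using Submodule.add_mem _ (hA v) (hB v)
  zero_mem' v := by simp
  smul_mem' c A hA v := by simpa using Submodule.smul_mem _ c (hA v)

/-- The horizontal component of a tangent vector: the values are projected orthogonally from `ℓᗮ`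
to `(ℓ ℍ)ᗮ ⊆ ℓᗮ`. -/
def horPart (ℓ : CP3) : TangentAt ℓ →ₗ[ℂ] TangentAt ℓ where
  toFun A := LinearMap.codRestrict ℓ.submoduleᗮ
    (((quatLine ℓ)ᗮ.starProjection : C4 →ₗ[ℂ] C4) ∘ₗ ℓ.submoduleᗮ.subtype ∘ₗ A)
    (fun v => Submodule.orthogonal_le (le_sup_left : ℓ.submodule ≤ quatLine ℓ)
      (Submodule.starProjection_apply_mem _ _))
  map_add' A B := by
    ext v : 2
    simp only [LinearMap.codRestrict_apply, LinearMap.comp_apply, LinearMap.add_apply, map_add,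
      Submodule.coe_add]
  map_smul' c A := by
    ext v : 2
    simp only [LinearMap.codRestrict_apply, LinearMap.comp_apply, LinearMap.smul_apply, map_smul,
      Submodule.coe_smul, RingHom.id_apply]

/-- The vertical component of a tangent vector (tangent to the fibre of the twistor fibration):
homomorphisms with values in `ℓᗮ ∩ ℓ ℍ = ℓ j`. -/
def vertPart (ℓ : CP3) : TangentAt ℓ →ₗ[ℂ] TangentAt ℓ :=
  LinearMap.id - horPart ℓ

/-- The usual (Kähler) complex structure of `ℂP³`. -/
def kahlerJ (ℓ : CP3) (A : TangentAt ℓ) : TangentAt ℓ := Complex.I • A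

/-- The nearly Kähler almost complex structure of `ℂP³`: the usual one on horizontal vectors, the
opposite of the usual one on vertical vectors. -/
def nearlyKahlerJ (ℓ : CP3) (A : TangentAt ℓ) : TangentAt ℓ :=
  Complex.I • horPart ℓ A - Complex.I • vertPart ℓ A

/-- The fibre at `ℓ` of the bundle `𝕍*`, the dual of the vertical tangent bundle. Through the
splitting of the tangent space it consists of the complex linear forms that vanish on the
horizontal space. -/
def contactSystem (ℓ : CP3) : Submodule ℂ (Module.Dual ℂ (TangentAt ℓ)) :=
  (horizontalSpace ℓ).dualAnnihilator

/-- For a subspace `S` of `T_ℓ = ℓ* ⊗ ℓᗮ`, the subspace `S ⊗ ℓ` of `ℂ⁴`, where `ℓ* ⊗ ℓ = ℂ`: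
it is spanned by the values of the members of `S`. -/
def tensorLine {ℓ : CP3} (S : Submodule ℂ (TangentAt ℓ)) : Submodule ℂ C4 :=
  Submodule.span ℂ {x | ∃ A ∈ S, ∃ v : ℓ.submodule, x = (A v : C4)}

/-- The quotient of the horizontal space at `ℓ` by a subspace `S`, realized as the orthogonal
complement of `S` in the horizontal space. -/
def normalSpace {ℓ : CP3} (S : Submodule ℂ (TangentAt ℓ)) : Submodule ℂ (TangentAt ℓ) where
  carrier := {A | A ∈ horizontalSpace ℓ ∧
    ∀ B ∈ S, ∀ v w : ℓ.submodule, ⟪(B v : C4), (A w : C4)⟫_ℂ = 0}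
  add_mem' hA hA' := ⟨Submodule.add_mem _ hA.1 hA'.1, fun B hB v w => by
    simp [hA.2 B hB v w, hA'.2 B hB v w]⟩
  zero_mem' := ⟨Submodule.zero_mem _, fun B hB v w => by simp⟩
  smul_mem' c A hA := ⟨Submodule.smul_mem _ c hA.1, fun B hB v w => by
    simp [hA.2 B hB v w]⟩

/-! ### The flag manifold -/

/-- The flag manifold: pairs `([e₁], [e₂])` of complex lines that are orthogonal for the
quaternionic product. -/
def Flag : Type :=
  {F : CP3 × CP3 // ∀ v ∈ F.1.submodule, ∀ w ∈ F.2.submodule, QuatOrthogonal v w}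

/-- The projection `([e₁], [e₂]) ↦ [e₁]`, to the nearly Kähler `ℂP³`. -/
def Flag.proj₁ (F : Flag) : CP3 := F.1.1

/-- The projection `([e₁], [e₂]) ↦ [e₂]`, to the Kähler `ℂP³`. -/
def Flag.proj₂ (F : Flag) : CP3 := F.1.2

/-! ### Maps from a Riemann surface to `ℂP³` -/

variable {M : Type*} [TopologicalSpace M] [ChartedSpace ℂ M]

/-- A family of subspaces of `ℂ⁴`, parametrized by `M`, is smooth: the orthogonal projections to
its members form a smooth map from `M`, as a real surface, to `End(ℂ⁴)`. -/
def SmoothFamily (W : M → Submodule ℂ C4) : Prop :=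
  ContMDiff 𝓘(ℝ, ℂ) 𝓘(ℝ, C4 →L[ℂ] C4) ∞ (fun q => (W q).starProjection)

/-- A map to `ℂP³` is smooth; `ℂP³` is a submanifold of `End(ℂ⁴)` through `ℓ ↦` (orthogonal
projection to `ℓ`). -/
def SmoothMap (X : M → CP3) : Prop := SmoothFamily (fun q => (X q).submodule)

/-- The derivative at `p`, in the direction `u`, of `q ↦` (orthogonal projection to `X q`). -/
def projectionDeriv (X : M → CP3) (p : M) (u : TangentSpace 𝓘(ℝ, ℂ) p) : C4 →L[ℂ] C4 :=
  mfderiv 𝓘(ℝ, ℂ) 𝓘(ℝ, C4 →L[ℂ] C4) (fun q => (X q).submodule.starProjection) p u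

/-- The differential of a map `X` to `ℂP³`, as a map `T_p M → Hom(ℓ, ℓᗮ)` with `ℓ = X p`. If `P_q`
is the orthogonal projection to `X q`, it sends `u` to `v ↦ (dP)_p(u) v`, which lies in `ℓᗮ` because
`P P = P`. If `s` is a nowhere vanishing local section of the lines `X q`, then this homomorphism
sends `s(p)` to the orthogonal projection of `ds_p(u)` to `ℓᗮ`, because `P s = s`. -/
def differential (X : M → CP3) (p : M) (u : TangentSpace 𝓘(ℝ, ℂ) p) : TangentAt (X p) :=
  ((X p).submoduleᗮ.orthogonalProjectionOnto : C4 →ₗ[ℂ] (X p).submoduleᗮ) ∘ₗ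
    (projectionDeriv X p u : C4 →ₗ[ℂ] C4) ∘ₗ (X p).submodule.subtype

/-- Multiplication by `i` on a tangent space of the Riemann surface `M`. -/
def surfaceJ {p : M} (u : TangentSpace 𝓘(ℝ, ℂ) p) : TangentSpace 𝓘(ℝ, ℂ) p :=
  (Complex.I * (show ℂ from u) : ℂ)

/-- Nonconstant smooth maps to `ℂP³` whose differential commutes with the almost complex structures,
for the structure `J` on `ℂP³`. -/
structure IsJCurve (J : ∀ ℓ : CP3, TangentAt ℓ → TangentAt ℓ) (X : M → CP3) : Prop where
  smooth : SmoothMap X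
  nonconstant : ¬ ∃ ℓ : CP3, ∀ p, X p = ℓ
  commutes : ∀ (p : M) (u : TangentSpace 𝓘(ℝ, ℂ) p),
    differential X p (surfaceJ u) = J (X p) (differential X p u)

/-- Pseudoholomorphic curves in the nearly Kähler `ℂP³`. -/
def IsPseudoholomorphicCurve (X : M → CP3) : Prop := IsJCurve nearlyKahlerJ X

/-- The form `𝐈₁`: the horizontal part of the differential. -/
def formI₁ (X : M → CP3) (p : M) (u : TangentSpace 𝓘(ℝ, ℂ) p) : TangentAt (X p) :=
  horPart (X p) (differential X p u)

/-- `L` is a smooth complex line subbundle of the pull-back by `X` of the horizontal bundle. -/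
structure IsHorizontalLineBundle (X : M → CP3) (L : ∀ p, Submodule ℂ (TangentAt (X p))) :
    Prop where
  horizontal : ∀ p, L p ≤ horizontalSpace (X p)
  rank_one : ∀ p, Module.finrank ℂ (L p) = 1
  smooth : SmoothFamily (fun p => tensorLine (L p))

/-- `L` is the line bundle in which `𝐈₁` takes its values. -/
structure IsTangentLine (X : M → CP3) (L : ∀ p, Submodule ℂ (TangentAt (X p))) : Prop
    extends IsHorizontalLineBundle X L where
  formI₁_mem : ∀ p u, formI₁ X p u ∈ L p

/-- An adapted moving frame over the open set `U`: smooth `e₁, e₂` with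
`⟨e₁, e₁⟩ = ⟨e₂, e₂⟩ = 1` and `⟨e₁, e₂⟩ = 0`, with `e₁` spanning `X`, and such that the tangent
vector `e₁* ⊗ e₂ j` spans `L`. -/
structure IsAdaptedFrame (X : M → CP3) (L : ∀ p, Submodule ℂ (TangentAt (X p))) (U : Set M)
    (e₁ e₂ : M → C4) : Prop where
  isOpen : IsOpen U
  smooth₁ : ContMDiffOn 𝓘(ℝ, ℂ) 𝓘(ℝ, C4) ∞ e₁ U
  smooth₂ : ContMDiffOn 𝓘(ℝ, ℂ) 𝓘(ℝ, C4) ∞ e₂ U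
  norm₁ : ∀ q ∈ U, ‖e₁ q‖ = 1
  norm₂ : ∀ q ∈ U, ‖e₂ q‖ = 1
  orthogonal : ∀ q ∈ U, QuatOrthogonal (e₁ q) (e₂ q)
  adapted : ∀ q ∈ U, ∃ h : e₁ q ∈ (X q).submodule,
    ∃ A ∈ L q, (A ⟨e₁ q, h⟩ : C4) = jMul (e₂ q)

/-- The connection form `κ_{2 1̄} = τ` in a moving frame, where
`de₂ = e₁ φ¹₂ + e₂ (i ρ₂ + j τ)`. -/
def kappa21 (e₂ : M → C4) (q : M) (u : TangentSpace 𝓘(ℝ, ℂ) q) : ℂ :=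
  ⟪jMul (e₂ q), (mfderiv 𝓘(ℝ, ℂ) 𝓘(ℝ, C4) e₂ q u : C4)⟫_ℂ

/-- The connection form `κ_{1 2̄} = - τ̄`. -/
def kappa12 (e₂ : M → C4) (q : M) (u : TangentSpace 𝓘(ℝ, ℂ) q) : ℂ :=
  - starRingEnd ℂ (kappa21 e₂ q u)

/-- The form `𝐈𝐈 = (f₁) ⊗ f₂* ⊗ κ_{1 2̄}` (the second fundamental form of `L` in the horizontal
bundle) vanishes: its coefficient is zero in every adapted frame. -/
def FormIIVanishes (X : M → CP3) (L : ∀ p, Submodule ℂ (TangentAt (X p))) : Prop :=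
  ∀ (U : Set M) (e₁ e₂ : M → C4), IsAdaptedFrame X L U e₁ e₂ →
    ∀ q ∈ U, ∀ u : TangentSpace 𝓘(ℝ, ℂ) q, kappa12 e₂ q u = 0

/-- Null-torsion pseudoholomorphic curves in the nearly Kähler `ℂP³`: `𝐈₁` is not identically zero
(so that `L` and `𝐈𝐈` are defined), and `𝐈𝐈` is identically zero. -/
structure IsNullTorsionCurve (X : M → CP3) : Prop where
  pseudoholomorphic : IsPseudoholomorphicCurve X
  not_vertical : ∃ p u, formI₁ X p u ≠ 0
  null_torsion : ∃ L, IsTangentLine X L ∧ FormIIVanishes X L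

/-- Nonconstant holomorphic integral curves of the contact system `𝕍*` on the Kähler `ℂP³`. -/
structure IsContactCurve (Y : M → CP3) : Prop where
  holomorphic : IsJCurve kahlerJ Y
  integral : ∀ p u, ∀ θ ∈ contactSystem (Y p), θ (differential Y p u) = 0

/-- `L` is a line subbundle of the horizontal bundle that contains the image of `dY`. -/
structure IsContactTangentLine (Y : M → CP3) (L : ∀ p, Submodule ℂ (TangentAt (Y p))) : Prop
    extends IsHorizontalLineBundle Y L where
  differential_mem : ∀ p u, differential Y p u ∈ L p

/-- `F` is the lift `p ↦ (X p, N_X(p) ⊗ X p)` of `X` to the flag manifold, with the normal line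
`N_X(p)`, the quotient of the horizontal space by `L p`. -/
def IsNormalLift (X : M → CP3) (L : ∀ p, Submodule ℂ (TangentAt (X p))) (F : M → Flag) : Prop :=
  ∀ p, (F p).proj₁ = X p ∧ (F p).proj₂.submodule = tensorLine (normalSpace (L p))

/-- `F` is the lift `p ↦ ((ℍ/L)(p) ⊗ Y p, Y p)` of `Y` to the flag manifold, with the quotient
`(ℍ/L)(p)` of the horizontal space by `L p`. -/
def IsContactLift (Y : M → CP3) (L : ∀ p, Submodule ℂ (TangentAt (Y p))) (F : M → Flag) : Prop :=
  ∀ p, (F p).proj₁.submodule = tensorLine (normalSpace (L p)) ∧ (F p).proj₂ = Y p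

end NearlyKahler

end

noncomputable section

namespace NearlyKahler

/-! ### Linear algebra of the quaternionic structure -/

/-! A line bundle `L` in the pulled-back horizontal bundle of `X` is the same as a map `Y` with `Y`
quaternionically orthogonal to `X` and `L = Hom(X, Y j)`, so everything can be read off from pairs
`(X, Y)` in the flag manifold. For local sections `x` of `X` and `y` of `Y`, the vectors `x, x j, y,
y j` are a basis of `ℂ⁴`. Modulo `x`, the form `dx` has components along `x j`, `y`, `y j`. Modulo
`y`, the form `dy` has components along `y j`, `x`, `x j`. Differentiating the two orthogonality
relations shows that `⟪y, dx⟫` and `⟪x, dy⟫` vanish together (`IsFlagPair.inner_eq_zero_iff`) and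
that `⟪y j, dx⟫ = ⟪x j, dy⟫` (`IsFlagPair.inner_jMul_eq`).

The form `𝐈₁` lies in `Hom(X, Y j)` iff `⟪y, dx⟫ = 0`, and `𝐈𝐈` vanishes iff `⟪y j, dy⟫ = 0` for
unit sections `y`. Together these say that `dY` lies in `Hom(Y, X j)`, that is, that `Y` is
horizontal with tangent line determined by `X`. The one component left in `dY` is the shared one. It
is complex linear on both sides, because the nearly Kähler structure is `i` on horizontal vectors
(`IsFlagPair.isContactCurve`).

In the other direction two things must be proved. First, the tangent line of a contact curve `Y`
must extend smoothly over the zeros of `dY`. For a holomorphic lift `s`, the derivative in a chart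
is a power of the coordinate times a nonvanishing holomorphic `g`, and `s, g` span the required
plane (`exists_holomorphic_frame`). Second, the vertical component `⟪x j, dx⟫` of the resulting `X`
must be complex antilinear. Taking `x = e j`, with `e` the part of `g` orthogonal to `s`, this
component equals `⟪dg, e j⟫`, which is conjugate linear because `g` is holomorphic
(`exists_local_partner`).

Uniqueness of both line bundles, and with it bijectivity, follows from continuity: the zeros of `dY`
are isolated (`eventually_differential_ne_zero`), and `𝐈₁` has the same zeros
(`IsFlagPair.formI₁_eq_zero_iff`). -/

lemma jMul_jMul (v : C4) : jMul (jMul v) = -v := by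
  ext i; fin_cases i <;> simp [jMul]

lemma inner_jMul_swap (v w : C4) : ⟪jMul v, w⟫_ℂ = -⟪jMul w, v⟫_ℂ := by
  simp [jMul, PiLp.inner_apply, Fin.sum_univ_four]; ring

lemma inner_jMul_jMul (v w : C4) : ⟪jMul v, jMul w⟫_ℂ = ⟪w, v⟫_ℂ := by
  simp [jMul, PiLp.inner_apply, Fin.sum_univ_four]; ring

lemma inner_jMul_self (v : C4) : ⟪jMul v, v⟫_ℂ = 0 := by
  simp [jMul, PiLp.inner_apply, Fin.sum_univ_four]; ring

lemma inner_self_jMul (v : C4) : ⟪v, jMul v⟫_ℂ = 0 :=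
  inner_eq_zero_symm.1 (inner_jMul_self v)

lemma inner_jMul_right (v w : C4) : ⟪v, jMul w⟫_ℂ = -⟪w, jMul v⟫_ℂ := by
  simp [jMul, PiLp.inner_apply, Fin.sum_univ_four]; ring

lemma jMul_ne_zero {v : C4} (hv : v ≠ 0) : jMul v ≠ 0 := fun h => by
  have := jMul_jMul v
  rw [h, map_zero] at this
  exact hv (neg_eq_zero.1 this.symm)

lemma QuatOrthogonal.symm {v w : C4} (h : QuatOrthogonal v w) : QuatOrthogonal w v :=
  ⟨inner_eq_zero_symm.1 h.1, by rw [inner_jMul_swap, h.2, neg_zero]⟩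

/-- For `x, y ≠ 0` orthogonal in the quaternionic sense, `x, x j, y, y j` is a basis of `ℂ⁴`. -/
lemma eq_zero_of_inner_eq_zero {x y v : C4} (hx : x ≠ 0) (hy : y ≠ 0) (h : QuatOrthogonal x y)
    (h₁ : ⟪x, v⟫_ℂ = 0) (h₂ : ⟪jMul x, v⟫_ℂ = 0) (h₃ : ⟪y, v⟫_ℂ = 0)
    (h₄ : ⟪jMul y, v⟫_ℂ = 0) : v = 0 := by
  by_contra hv
  have hs := h.symm
  have e₁ : ⟪x, jMul y⟫_ℂ = 0 := inner_eq_zero_symm.1 hs.2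
  have e₂ : ⟪y, jMul x⟫_ℂ = 0 := inner_eq_zero_symm.1 h.2
  have hli : LinearIndependent ℂ ![x, jMul x, y, jMul y, v] := by
    apply linearIndependent_of_ne_zero_of_inner_eq_zero (𝕜 := ℂ)
    · intro i
      fin_cases i
      exacts [hx, jMul_ne_zero hx, hy, jMul_ne_zero hy, hv]
    · intro i k hik
      fin_cases i <;> fin_cases k <;>
        first
        | exact absurd rfl hik
        | simp [h.1, h.2, hs.1, hs.2, h₁, h₂, h₃, h₄, e₁, e₂, inner_jMul_self, inner_self_jMul,
            inner_jMul_jMul, inner_eq_zero_symm.1 h₁, inner_eq_zero_symm.1 h₂,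
            inner_eq_zero_symm.1 h₃, inner_eq_zero_symm.1 h₄]
  have := hli.fintype_card_le_finrank
  simp at this

lemma eq_of_inner_eq {x y v w : C4} (hx : x ≠ 0) (hy : y ≠ 0) (h : QuatOrthogonal x y)
    (h₁ : ⟪x, v⟫_ℂ = ⟪x, w⟫_ℂ) (h₂ : ⟪jMul x, v⟫_ℂ = ⟪jMul x, w⟫_ℂ)
    (h₃ : ⟪y, v⟫_ℂ = ⟪y, w⟫_ℂ) (h₄ : ⟪jMul y, v⟫_ℂ = ⟪jMul y, w⟫_ℂ) : v = w := by
  rw [← sub_eq_zero]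
  apply eq_zero_of_inner_eq_zero hx hy h <;> rw [inner_sub_right, sub_eq_zero] <;> assumption

lemma exists_eq_span_of_finrank_eq_one {V : Type*} [AddCommGroup V] [Module ℂ V]
    {S : Submodule ℂ V} (hS : Module.finrank ℂ S = 1) :
    ∃ v, v ≠ 0 ∧ S = Submodule.span ℂ {v} := by
  obtain ⟨⟨v, hv⟩, hv0, h⟩ := finrank_eq_one_iff'.1 hS
  refine ⟨v, fun e => hv0 (Subtype.ext e), le_antisymm (fun w hw => ?_)
    (Submodule.span_le.2 (Set.singleton_subset_iff.2 hv))⟩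
  obtain ⟨c, hc⟩ := h ⟨w, hw⟩
  exact Submodule.mem_span_singleton.2 ⟨c, congrArg Subtype.val hc⟩

lemma eq_span_of_finrank_eq_one {V : Type*} [AddCommGroup V] [Module ℂ V]
    {S : Submodule ℂ V} (hS : Module.finrank ℂ S = 1) {v : V} (hv : v ≠ 0) (hvS : v ∈ S) :
    S = Submodule.span ℂ {v} := by
  obtain ⟨w, hw, rfl⟩ := exists_eq_span_of_finrank_eq_one hS
  obtain ⟨c, rfl⟩ := Submodule.mem_span_singleton.1 hvS
  have hc : c ≠ 0 := by rintro rfl; simp at hv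
  rw [Submodule.span_singleton_smul_eq (IsUnit.mk0 c hc)]

lemma finrank_span_singleton_eq_one {V : Type*} [AddCommGroup V] [Module ℂ V] {v : V}
    (hv : v ≠ 0) : Module.finrank ℂ (Submodule.span ℂ {v}) = 1 :=
  finrank_span_singleton hv

/-! ### Complex lines and their tangent spaces -/

lemma exists_mem_ne_zero (ℓ : CP3) : ∃ x ∈ ℓ.submodule, x ≠ 0 :=
  ⟨ℓ.rep, by rw [Projectivization.submodule_eq]; exact Submodule.mem_span_singleton_self _,
    ℓ.rep_nonzero⟩

lemma submodule_eq_span {ℓ : CP3} {x : C4} (hx : x ∈ ℓ.submodule) (h0 : x ≠ 0) :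
    ℓ.submodule = Submodule.span ℂ {x} := by
  rw [Projectivization.submodule_eq] at hx ⊢
  obtain ⟨c, rfl⟩ := Submodule.mem_span_singleton.1 hx
  have hc : c ≠ 0 := by rintro rfl; simp at h0
  rw [Submodule.span_singleton_smul_eq (IsUnit.mk0 c hc)]

lemma exists_submodule_eq_span {x : C4} (h0 : x ≠ 0) :
    ∃ ℓ : CP3, ℓ.submodule = Submodule.span ℂ {x} :=
  ⟨Projectivization.mk ℂ x h0, Projectivization.submodule_mk _ _⟩

lemma tangent_ext {ℓ : CP3} {x : C4} (hx : x ∈ ℓ.submodule) (h0 : x ≠ 0) {A B : TangentAt ℓ}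
    (h : (A ⟨x, hx⟩ : C4) = B ⟨x, hx⟩) : A = B := by
  ext v : 1
  obtain ⟨v, hv⟩ := v
  obtain ⟨c, rfl⟩ := Submodule.mem_span_singleton.1 (submodule_eq_span hx h0 ▸ hv)
  have : (⟨c • x, hv⟩ : ℓ.submodule) = c • ⟨x, hx⟩ := rfl
  rw [this, map_smul, map_smul, Subtype.ext h]

lemma exists_smul_eq {ℓ : CP3} {x : C4} (hx : x ∈ ℓ.submodule) (h0 : x ≠ 0) (v : ℓ.submodule) :
    ∃ c : ℂ, v = c • (⟨x, hx⟩ : ℓ.submodule) := by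
  obtain ⟨v, hv⟩ := v
  obtain ⟨c, rfl⟩ := Submodule.mem_span_singleton.1 (submodule_eq_span hx h0 ▸ hv)
  exact ⟨c, rfl⟩

lemma exists_tangent {ℓ : CP3} {x w : C4} (hx : x ∈ ℓ.submodule) (h0 : x ≠ 0)
    (hw : ⟪x, w⟫_ℂ = 0) : ∃ A : TangentAt ℓ, (A ⟨x, hx⟩ : C4) = w := by
  have hw' : w ∈ ℓ.submoduleᗮ := by
    rw [submodule_eq_span hx h0, Submodule.mem_orthogonal_singleton_iff_inner_right]; exact hw
  -- The homomorphism is `v ↦ (⟪x, v⟫ / ⟪x, x⟫) • w`.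
  refine ⟨((innerSL ℂ ((⟪x, x⟫_ℂ)⁻¹ • x) : C4 →ₗ[ℂ] ℂ) ∘ₗ ℓ.submodule.subtype).smulRight
    (⟨w, hw'⟩ : (ℓ.submoduleᗮ : Submodule ℂ C4)), ?_⟩
  have hxx : ⟪x, x⟫_ℂ ≠ 0 := inner_self_ne_zero.2 h0
  have : ((starRingEnd ℂ) ⟪x, x⟫_ℂ)⁻¹ * ⟪x, x⟫_ℂ = 1 := by
    rw [inner_conj_symm]; exact inv_mul_cancel₀ hxx
  simp only [LinearMap.smulRight_apply, LinearMap.comp_apply, Submodule.subtype_apply,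
    ContinuousLinearMap.coe_coe, innerSL_apply_apply, inner_smul_left,
    map_inv₀, this, one_smul]

lemma inner_tangent {ℓ : CP3} {x : C4} (hx : x ∈ ℓ.submodule) (A : TangentAt ℓ)
    (v : ℓ.submodule) : ⟪x, (A v : C4)⟫_ℂ = 0 :=
  (Submodule.mem_orthogonal _ _).1 (A v).2 x hx

lemma mem_quatLine_orthogonal {ℓ : CP3} {x w : C4} (hx : x ∈ ℓ.submodule) (h0 : x ≠ 0) :
    w ∈ (quatLine ℓ)ᗮ ↔ QuatOrthogonal x w := by
  have e : quatLine ℓ = Submodule.span ℂ {x} ⊔ Submodule.span ℂ {jMul x} := by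
    apply le_antisymm
    · refine sup_le ((submodule_eq_span hx h0).le.trans le_sup_left) (le_sup_of_le_right ?_)
      rw [Submodule.span_le]
      rintro _ ⟨v, hv, rfl⟩
      obtain ⟨c, rfl⟩ := Submodule.mem_span_singleton.1 (submodule_eq_span hx h0 ▸ hv)
      rw [map_smulₛₗ]
      exact Submodule.smul_mem _ _ (Submodule.mem_span_singleton_self _)
    · refine sup_le ((submodule_eq_span hx h0).ge.trans le_sup_left) (le_sup_of_le_right ?_)
      exact Submodule.span_mono (by rintro _ rfl; exact ⟨x, hx, rfl⟩)
  rw [e, ← Submodule.inf_orthogonal, Submodule.mem_inf,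
    Submodule.mem_orthogonal_singleton_iff_inner_right,
    Submodule.mem_orthogonal_singleton_iff_inner_right]
  rfl

lemma mem_horizontalSpace_iff {ℓ : CP3} {x : C4} (hx : x ∈ ℓ.submodule) (h0 : x ≠ 0)
    {A : TangentAt ℓ} : A ∈ horizontalSpace ℓ ↔ ⟪jMul x, (A ⟨x, hx⟩ : C4)⟫_ℂ = 0 := by
  constructor
  · intro h
    exact ((mem_quatLine_orthogonal hx h0).1 (h ⟨x, hx⟩)).2
  · intro h v
    obtain ⟨c, rfl⟩ := exists_smul_eq hx h0 v
    rw [map_smul]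
    exact Submodule.smul_mem _ c ((mem_quatLine_orthogonal hx h0).2 ⟨inner_tangent hx A _, h⟩)

lemma horPart_mem_horizontalSpace {ℓ : CP3} (A : TangentAt ℓ) :
    horPart ℓ A ∈ horizontalSpace ℓ := fun _ => Submodule.starProjection_apply_mem _ _

lemma inner_horPart {ℓ : CP3} {w : C4} (hw : w ∈ (quatLine ℓ)ᗮ) (A : TangentAt ℓ)
    (v : ℓ.submodule) : ⟪w, (horPart ℓ A v : C4)⟫_ℂ = ⟪w, (A v : C4)⟫_ℂ := by
  have : (horPart ℓ A v : C4) = (quatLine ℓ)ᗮ.starProjection (A v : C4) := rfl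
  rw [this, ← Submodule.inner_starProjection_left_eq_right,
    Submodule.starProjection_eq_self_iff.2 hw]

/-- The line of homomorphisms from `ℓ` to the line `m j`. -/
def tangentLine (ℓ m : CP3) : Submodule ℂ (TangentAt ℓ) where
  carrier := {A | ∀ v, (A v : C4) ∈ m.submodule.map jMul}
  add_mem' hA hB v := by simpa using Submodule.add_mem _ (hA v) (hB v)
  zero_mem' v := by simp
  smul_mem' c A hA v := by simpa using Submodule.smul_mem _ c (hA v)

/-- The lines `ℓ, m` are orthogonal for the quaternionic product. -/
def LineOrthogonal (ℓ m : CP3) : Prop :=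
  ∀ v ∈ ℓ.submodule, ∀ w ∈ m.submodule, QuatOrthogonal v w

lemma LineOrthogonal.symm {ℓ m : CP3} (h : LineOrthogonal ℓ m) : LineOrthogonal m ℓ :=
  fun v hv w hw => (h w hw v hv).symm

lemma map_jMul_eq_span {m : CP3} {y : C4} (hy : y ∈ m.submodule) (h0 : y ≠ 0) :
    m.submodule.map jMul = Submodule.span ℂ {jMul y} := by
  rw [submodule_eq_span hy h0, Submodule.map_span, Set.image_singleton]

lemma map_jMul_map_jMul (W : Submodule ℂ C4) : (W.map jMul).map jMul = W := by
  ext v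
  constructor
  · rintro ⟨_, ⟨w, hw, rfl⟩, rfl⟩
    rw [jMul_jMul]
    exact W.neg_mem hw
  · intro hv
    exact ⟨jMul (-v), ⟨-v, W.neg_mem hv, rfl⟩, by rw [jMul_jMul, neg_neg]⟩

/-- In the basis `x, x j, y, y j` a tangent vector has no `x` component. Horizontality removes the
`x j` component and the last condition removes the `y` component, so only `y j` remains. -/
lemma mem_tangentLine_iff {ℓ m : CP3} {x y : C4} (hx : x ∈ ℓ.submodule) (hx0 : x ≠ 0)
    (hy : y ∈ m.submodule) (hy0 : y ≠ 0) (h : LineOrthogonal ℓ m) {A : TangentAt ℓ} :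
    A ∈ tangentLine ℓ m ↔ A ∈ horizontalSpace ℓ ∧ ⟪y, (A ⟨x, hx⟩ : C4)⟫_ℂ = 0 := by
  have hxy := h x hx y hy
  have e₁ : ⟪jMul x, jMul y⟫_ℂ = 0 := by rw [inner_jMul_jMul]; exact hxy.symm.1
  have e₂ : ⟪x, jMul y⟫_ℂ = 0 := inner_eq_zero_symm.1 hxy.symm.2
  have hyy : ⟪jMul y, jMul y⟫_ℂ ≠ 0 := inner_self_ne_zero.2 (jMul_ne_zero hy0)
  rw [mem_horizontalSpace_iff hx hx0]
  constructor
  · intro hA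
    have := hA ⟨x, hx⟩
    rw [map_jMul_eq_span hy hy0] at this
    obtain ⟨c, hc⟩ := Submodule.mem_span_singleton.1 this
    rw [← hc, inner_smul_right, inner_smul_right, inner_self_jMul, e₁]
    simp
  · rintro ⟨h₁, h₂⟩ v
    obtain ⟨c, rfl⟩ := exists_smul_eq hx hx0 v
    rw [map_smul]
    refine Submodule.smul_mem _ c ?_
    rw [map_jMul_eq_span hy hy0]
    refine Submodule.mem_span_singleton.2
      ⟨⟪jMul y, (A ⟨x, hx⟩ : C4)⟫_ℂ / ⟪jMul y, jMul y⟫_ℂ, ?_⟩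
    apply eq_of_inner_eq hx0 hy0 hxy
    · rw [inner_tangent hx, inner_smul_right, e₂, mul_zero]
    · rw [h₁, inner_smul_right, e₁, mul_zero]
    · rw [h₂, inner_smul_right, inner_self_jMul, mul_zero]
    · rw [inner_smul_right, div_mul_cancel₀ _ hyy]

lemma tangentLine_le {ℓ m : CP3} (h : LineOrthogonal ℓ m) :
    tangentLine ℓ m ≤ horizontalSpace ℓ := by
  obtain ⟨x, hx, hx0⟩ := exists_mem_ne_zero ℓ
  obtain ⟨y, hy, hy0⟩ := exists_mem_ne_zero m
  exact fun A hA => ((mem_tangentLine_iff hx hx0 hy hy0 h).1 hA).1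

lemma exists_mem_tangentLine {ℓ m : CP3} {x y : C4} (hx : x ∈ ℓ.submodule) (hx0 : x ≠ 0)
    (hy : y ∈ m.submodule) (h : LineOrthogonal ℓ m) :
    ∃ A ∈ tangentLine ℓ m, (A ⟨x, hx⟩ : C4) = jMul y := by
  obtain ⟨A, hA⟩ := exists_tangent (w := jMul y) hx hx0
    (inner_eq_zero_symm.1 (h x hx y hy).symm.2)
  refine ⟨A, fun v => ?_, hA⟩
  obtain ⟨c, rfl⟩ := exists_smul_eq hx hx0 v
  rw [map_smul, Submodule.coe_smul, hA]
  exact Submodule.smul_mem _ c ⟨y, hy, rfl⟩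

lemma tensorLine_tangentLine {ℓ m : CP3} (h : LineOrthogonal ℓ m) :
    tensorLine (tangentLine ℓ m) = m.submodule.map jMul := by
  apply le_antisymm
  · refine Submodule.span_le.2 ?_
    rintro _ ⟨A, hA, v, rfl⟩
    exact hA v
  · rintro _ ⟨y, hy, rfl⟩
    obtain ⟨x, hx, hx0⟩ := exists_mem_ne_zero ℓ
    obtain ⟨A, hA, hAx⟩ := exists_mem_tangentLine hx hx0 hy h
    exact Submodule.subset_span ⟨A, hA, ⟨x, hx⟩, hAx.symm⟩

lemma finrank_tangentLine {ℓ m : CP3} (h : LineOrthogonal ℓ m) :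
    Module.finrank ℂ (tangentLine ℓ m) = 1 := by
  obtain ⟨x, hx, hx0⟩ := exists_mem_ne_zero ℓ
  obtain ⟨y, hy, hy0⟩ := exists_mem_ne_zero m
  obtain ⟨A, hA, hAx⟩ := exists_mem_tangentLine hx hx0 hy h
  have hA0 : A ≠ 0 := by
    rintro rfl
    exact jMul_ne_zero hy0 hAx.symm
  have e : tangentLine ℓ m = Submodule.span ℂ {A} := by
    refine le_antisymm (fun B hB => ?_) (Submodule.span_le.2 (Set.singleton_subset_iff.2 hA))
    have := hB ⟨x, hx⟩
    rw [map_jMul_eq_span hy hy0] at this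
    obtain ⟨c, hc⟩ := Submodule.mem_span_singleton.1 this
    refine Submodule.mem_span_singleton.2 ⟨c, tangent_ext hx hx0 ?_⟩
    rw [LinearMap.smul_apply, Submodule.coe_smul, hAx, hc]
  rw [e]
  exact finrank_span_singleton_eq_one hA0

/-- Every complex line in the horizontal space at `ℓ` is `Hom(ℓ, m j)`, with a line `m` in the
orthogonal complement of `ℓ ℍ`. -/
lemma exists_eq_tangentLine {ℓ : CP3} {S : Submodule ℂ (TangentAt ℓ)}
    (hS : S ≤ horizontalSpace ℓ) (h1 : Module.finrank ℂ S = 1) :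
    ∃ m, LineOrthogonal ℓ m ∧ S = tangentLine ℓ m := by
  obtain ⟨x, hx, hx0⟩ := exists_mem_ne_zero ℓ
  obtain ⟨A, hA0, rfl⟩ := exists_eq_span_of_finrank_eq_one h1
  have hA := Submodule.mem_span_singleton_self (R := ℂ) A
  have hw0 : (A ⟨x, hx⟩ : C4) ≠ 0 := fun e => hA0 (tangent_ext hx hx0 (B := 0) e)
  have hw := (mem_quatLine_orthogonal hx hx0).1 (hS hA ⟨x, hx⟩)
  set w : C4 := (A ⟨x, hx⟩ : C4)
  -- Since `j j = -1`, the line with `m j` spanned by `w` is the line spanned by `w j`.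
  obtain ⟨m, hm⟩ := exists_submodule_eq_span (jMul_ne_zero hw0)
  have hy : jMul w ∈ m.submodule := hm ▸ Submodule.mem_span_singleton_self _
  have horth : LineOrthogonal ℓ m := by
    intro a ha b hb
    obtain ⟨c, rfl⟩ := Submodule.mem_span_singleton.1 (submodule_eq_span hx hx0 ▸ ha)
    obtain ⟨d, rfl⟩ := Submodule.mem_span_singleton.1 (hm ▸ hb)
    have e : ⟪x, jMul w⟫_ℂ = 0 := inner_eq_zero_symm.1 hw.symm.2
    constructor
    · rw [inner_smul_left, inner_smul_right, e]; simp
    · rw [map_smulₛₗ, inner_smul_left, inner_smul_right, inner_jMul_jMul, hw.symm.1]; simp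
  have hAm : A ∈ tangentLine ℓ m :=
    (mem_tangentLine_iff hx hx0 hy (jMul_ne_zero hw0) horth).2 ⟨hS hA, inner_jMul_self w⟩
  exact ⟨m, horth, (eq_span_of_finrank_eq_one (finrank_tangentLine horth) hA0 hAm).symm⟩

/-- The horizontal space is `Hom(ℓ, m ⊕ m j)`, and the complement of `Hom(ℓ, m j)` in it is `Hom(ℓ,
m)`. This identifies the lifts to the flag manifold built from quotient bundles with the pairs `(X,
Y)`. -/
lemma tensorLine_normalSpace {ℓ m : CP3} (h : LineOrthogonal ℓ m) :
    tensorLine (normalSpace (tangentLine ℓ m)) = m.submodule := by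
  obtain ⟨x, hx, hx0⟩ := exists_mem_ne_zero ℓ
  obtain ⟨y, hy, hy0⟩ := exists_mem_ne_zero m
  have hxy := h x hx y hy
  have hyy : ⟪y, y⟫_ℂ ≠ 0 := inner_self_ne_zero.2 hy0
  apply le_antisymm
  · refine Submodule.span_le.2 ?_
    rintro _ ⟨A, hA, v, rfl⟩
    obtain ⟨B, hB, hBx⟩ := exists_mem_tangentLine hx hx0 hy h
    have h₁ := hA.2 B hB ⟨x, hx⟩ v
    rw [hBx] at h₁
    have h₂ := (mem_quatLine_orthogonal hx hx0).1 (hA.1 v)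
    have : (A v : C4) = (⟪y, (A v : C4)⟫_ℂ / ⟪y, y⟫_ℂ) • y := by
      apply eq_of_inner_eq hx0 hy0 hxy
      · rw [h₂.1, inner_smul_right, hxy.1, mul_zero]
      · rw [h₂.2, inner_smul_right, hxy.2, mul_zero]
      · rw [inner_smul_right, div_mul_cancel₀ _ hyy]
      · rw [h₁, inner_smul_right, inner_jMul_self, mul_zero]
    rw [this]
    exact m.submodule.smul_mem _ hy
  · intro w hw
    obtain ⟨A, hA⟩ := exists_tangent (w := w) hx hx0 (h x hx w hw).1
    refine Submodule.subset_span ⟨A, ⟨?_, ?_⟩, ⟨x, hx⟩, hA.symm⟩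
    · rw [mem_horizontalSpace_iff hx hx0, hA]
      exact (h x hx w hw).2
    · intro B hB v v'
      obtain ⟨c, rfl⟩ := exists_smul_eq hx hx0 v'
      obtain ⟨d, hd⟩ := Submodule.mem_span_singleton.1 (map_jMul_eq_span hy hy0 ▸ hB v)
      obtain ⟨c', rfl⟩ := Submodule.mem_span_singleton.1 (submodule_eq_span hy hy0 ▸ hw)
      rw [← hd, map_smul, Submodule.coe_smul, hA, inner_smul_left, inner_smul_right,
        inner_smul_right, inner_jMul_self]
      simp

lemma eq_of_tangentLine_eq {ℓ m m' : CP3} (h : LineOrthogonal ℓ m) (h' : LineOrthogonal ℓ m')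
    (e : tangentLine ℓ m = tangentLine ℓ m') : m = m' := by
  apply Projectivization.submodule_injective
  rw [← tensorLine_normalSpace h, ← tensorLine_normalSpace h', e]

/-- The nearly Kähler structure in terms of the components along `x j`, `y` and `y j`. -/
lemma eq_nearlyKahlerJ_iff {ℓ m : CP3} {x y : C4} (hx : x ∈ ℓ.submodule) (hx0 : x ≠ 0)
    (hy : y ∈ m.submodule) (hy0 : y ≠ 0) (h : LineOrthogonal ℓ m) {A B : TangentAt ℓ} :
    B = nearlyKahlerJ ℓ A ↔
      ⟪jMul x, (B ⟨x, hx⟩ : C4)⟫_ℂ = -(Complex.I * ⟪jMul x, (A ⟨x, hx⟩ : C4)⟫_ℂ) ∧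
      ⟪y, (B ⟨x, hx⟩ : C4)⟫_ℂ = Complex.I * ⟪y, (A ⟨x, hx⟩ : C4)⟫_ℂ ∧
      ⟪jMul y, (B ⟨x, hx⟩ : C4)⟫_ℂ = Complex.I * ⟪jMul y, (A ⟨x, hx⟩ : C4)⟫_ℂ := by
  have hxy := h x hx y hy
  have e₁ : ⟪jMul x, jMul y⟫_ℂ = 0 := by rw [inner_jMul_jMul]; exact hxy.symm.1
  have e₂ : ⟪x, jMul y⟫_ℂ = 0 := inner_eq_zero_symm.1 hxy.symm.2
  have hyq : y ∈ (quatLine ℓ)ᗮ := (mem_quatLine_orthogonal hx hx0).2 hxy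
  have hjyq : jMul y ∈ (quatLine ℓ)ᗮ := (mem_quatLine_orthogonal hx hx0).2 ⟨e₂, e₁⟩
  have hJ : (nearlyKahlerJ ℓ A ⟨x, hx⟩ : C4) = Complex.I • (horPart ℓ A ⟨x, hx⟩ : C4) -
      Complex.I • ((A ⟨x, hx⟩ : C4) - (horPart ℓ A ⟨x, hx⟩ : C4)) := rfl
  have hxh := (mem_horizontalSpace_iff hx hx0).1 (horPart_mem_horizontalSpace A)
  have k₁ : ⟪jMul x, (nearlyKahlerJ ℓ A ⟨x, hx⟩ : C4)⟫_ℂ =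
      -(Complex.I * ⟪jMul x, (A ⟨x, hx⟩ : C4)⟫_ℂ) := by
    rw [hJ]; simp only [inner_sub_right, inner_smul_right, hxh]; ring
  have k₂ : ⟪y, (nearlyKahlerJ ℓ A ⟨x, hx⟩ : C4)⟫_ℂ =
      Complex.I * ⟪y, (A ⟨x, hx⟩ : C4)⟫_ℂ := by
    rw [hJ]; simp only [inner_sub_right, inner_smul_right, inner_horPart hyq]; ring
  have k₃ : ⟪jMul y, (nearlyKahlerJ ℓ A ⟨x, hx⟩ : C4)⟫_ℂ =
      Complex.I * ⟪jMul y, (A ⟨x, hx⟩ : C4)⟫_ℂ := by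
    rw [hJ]; simp only [inner_sub_right, inner_smul_right, inner_horPart hjyq]; ring
  constructor
  · rintro rfl
    exact ⟨k₁, k₂, k₃⟩
  · rintro ⟨h₁, h₂, h₃⟩
    apply tangent_ext hx hx0
    apply eq_of_inner_eq hx0 hy0 hxy
    · rw [inner_tangent hx, inner_tangent hx]
    · rw [h₁, k₁]
    · rw [h₂, k₂]
    · rw [h₃, k₃]

/-! ### Derivatives of functions on the surface -/

/-- The projection is `‖v‖⁻²` times the rank one operator of `v`. Through this formula a smooth
nonvanishing section makes its line a smooth family. -/
lemma contDiffAt_starProjection_span {v : C4} (hv : v ≠ 0) :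
    ContDiffAt ℝ ∞ (fun v : C4 => (Submodule.span ℂ {v}).starProjection) v := by
  -- The rank one operator is conjugate linear in its second vector, so it is bilinear only over
  -- `ℝ`.
  have hb : IsBoundedBilinearMap ℝ (fun z : C4 × C4 => InnerProductSpace.rankOne ℂ z.1 z.2) :=
    { add_left := fun x₁ x₂ y => by
        ext1 z
        simp only [map_add, add_apply]
      smul_left := fun c x y => by
        ext1 z
        simp only [InnerProductSpace.rankOne_apply, smul_apply]
        exact smul_comm _ _ _
      add_right := fun x y₁ y₂ => map_add _ _ _
      smul_right := fun c x y => by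
        ext1 z
        simp only [InnerProductSpace.rankOne_apply, smul_apply,
          inner_smul_left_eq_smul, smul_assoc]
      bound := ⟨1, one_pos, fun x y => by simp⟩ }
  have e : (fun v : C4 => (Submodule.span ℂ {v}).starProjection) =
      fun v => ((‖v‖ ^ 2)⁻¹ : ℝ) • InnerProductSpace.rankOne ℂ v v := by
    funext v
    ext1 w
    rw [Submodule.starProjection_singleton]
    simp only [smul_apply, InnerProductSpace.rankOne_apply]
    rw [div_eq_inv_mul, mul_smul, ← Complex.coe_smul (‖v‖ ^ 2)⁻¹, Complex.ofReal_inv]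
    rfl
  rw [e]
  refine ContDiffAt.smul (ContDiffAt.inv (contDiff_norm_sq ℝ).contDiffAt ?_) ?_
  · simpa using hv
  · exact (hb.contDiff.comp (contDiff_id.prodMk contDiff_id)).contDiffAt

/-- Right multiplication by `j`, as a real linear map. -/
def jMulReal : C4 →L[ℝ] C4 :=
  LinearMap.toContinuousLinearMap
    { toFun := jMul
      map_add' := map_add jMul
      map_smul' := fun c v => by
        rw [← Complex.coe_smul, map_smulₛₗ, Complex.conj_ofReal, Complex.coe_smul]
        rfl }

variable {M : Type*} [TopologicalSpace M] [ChartedSpace ℂ M]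
variable {E : Type*} [NormedAddCommGroup E] [NormedSpace ℝ E]

/-- The derivative at `p` of a vector valued function on the surface, as a linear map on `ℂ`, the
model of the tangent space at `p`. -/
def surfaceDeriv (f : M → E) (p : M) : ℂ →L[ℝ] E := mfderiv 𝓘(ℝ, ℂ) 𝓘(ℝ, E) f p

lemma hasFDerivAt_chart {f : M → E} {p : M} (hf : MDifferentiableAt 𝓘(ℝ, ℂ) 𝓘(ℝ, E) f p) :
    HasFDerivAt (f ∘ (chartAt ℂ p).symm) (surfaceDeriv f p) (chartAt ℂ p p) := by
  have := hf.hasMFDerivAt.2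
  simp only [modelWithCornersSelf_coe, Set.range_id] at this
  exact hasFDerivWithinAt_univ.1 this

lemma surfaceDeriv_eq {f : M → E} {p : M} (hf : MDifferentiableAt 𝓘(ℝ, ℂ) 𝓘(ℝ, E) f p)
    {f' : ℂ →L[ℝ] E} (h : HasFDerivAt (f ∘ (chartAt ℂ p).symm) f' (chartAt ℂ p p)) :
    surfaceDeriv f p = f' := (hasFDerivAt_chart hf).unique h

lemma chart_symm_apply_chart (p : M) : (chartAt ℂ p).symm (chartAt ℂ p p) = p :=
  (chartAt ℂ p).left_inv (mem_chart_source ℂ p)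

lemma eventually_chart {p : M} {P : M → Prop} (h : ∀ᶠ q in nhds p, P q) :
    ∀ᶠ z in nhds (chartAt ℂ p p), P ((chartAt ℂ p).symm z) :=
  ((chartAt ℂ p).tendsto_symm (mem_chart_source ℂ p)).eventually h

lemma inner_surfaceDeriv_add {a b : M → C4} {p : M}
    (ha : MDifferentiableAt 𝓘(ℝ, ℂ) 𝓘(ℝ, C4) a p) (hb : MDifferentiableAt 𝓘(ℝ, ℂ) 𝓘(ℝ, C4) b p)
    {c : ℂ} (h : ∀ᶠ q in nhds p, ⟪a q, b q⟫_ℂ = c) (u : ℂ) :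
    ⟪a p, surfaceDeriv b p u⟫_ℂ + ⟪surfaceDeriv a p u, b p⟫_ℂ = 0 := by
  have h₁ := (hasFDerivAt_chart ha).inner ℂ (hasFDerivAt_chart hb)
  have h₂ : (fun z => ⟪(a ∘ (chartAt ℂ p).symm) z, (b ∘ (chartAt ℂ p).symm) z⟫_ℂ)
      =ᶠ[nhds (chartAt ℂ p p)] fun _ => c := eventually_chart h
  have h₃ := (h₁.congr_of_eventuallyEq h₂.symm).unique (hasFDerivAt_const _ _)
  have := DFunLike.congr_fun h₃ u
  simpa [fderivInnerCLM_apply, chart_symm_apply_chart] using this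

lemma mdifferentiableAt_jMul {a : M → C4} {p : M}
    (ha : MDifferentiableAt 𝓘(ℝ, ℂ) 𝓘(ℝ, C4) a p) :
    MDifferentiableAt 𝓘(ℝ, ℂ) 𝓘(ℝ, C4) (fun q => jMul (a q)) p :=
  jMulReal.mdifferentiableAt.comp p ha

lemma surfaceDeriv_jMul {a : M → C4} {p : M}
    (ha : MDifferentiableAt 𝓘(ℝ, ℂ) 𝓘(ℝ, C4) a p) (u : ℂ) :
    surfaceDeriv (fun q => jMul (a q)) p u = jMul (surfaceDeriv a p u) := by
  rw [surfaceDeriv_eq (mdifferentiableAt_jMul ha)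
    (jMulReal.hasFDerivAt.comp _ (hasFDerivAt_chart ha))]
  rfl

/-- The pairing `⟪v j, w⟫` is complex bilinear and skew, so differentiating its vanishing gives an
equality without conjugates. This is why complex linearity passes unchanged from one curve to the
other. -/
lemma jMul_surfaceDeriv_add {a b : M → C4} {p : M}
    (ha : MDifferentiableAt 𝓘(ℝ, ℂ) 𝓘(ℝ, C4) a p) (hb : MDifferentiableAt 𝓘(ℝ, ℂ) 𝓘(ℝ, C4) b p)
    (h : ∀ᶠ q in nhds p, ⟪jMul (a q), b q⟫_ℂ = 0) (u : ℂ) :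
    ⟪jMul (a p), surfaceDeriv b p u⟫_ℂ = ⟪jMul (b p), surfaceDeriv a p u⟫_ℂ := by
  have := inner_surfaceDeriv_add (mdifferentiableAt_jMul ha) hb h u
  rw [surfaceDeriv_jMul ha, inner_jMul_swap _ (b p), add_neg_eq_zero] at this
  exact this

/-! ### Sections of line bundles -/

/-- `x` is a section of the lines `X` near `p`, differentiable and not zero at `p`. -/
structure IsSectionAt (X : M → CP3) (p : M) (x : M → C4) : Prop where
  mdifferentiableAt : MDifferentiableAt 𝓘(ℝ, ℂ) 𝓘(ℝ, C4) x p
  ne_zero : x p ≠ 0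
  eventually_mem : ∀ᶠ q in nhds p, x q ∈ (X q).submodule

lemma IsSectionAt.mem {X : M → CP3} {p : M} {x : M → C4} (h : IsSectionAt X p x) :
    x p ∈ (X p).submodule := h.eventually_mem.self_of_nhds

lemma contMDiffAt_apply {P : M → C4 →L[ℂ] C4} {p : M}
    (hP : ContMDiffAt 𝓘(ℝ, ℂ) 𝓘(ℝ, C4 →L[ℂ] C4) ∞ P p) (v : C4) :
    ContMDiffAt 𝓘(ℝ, ℂ) 𝓘(ℝ, C4) ∞ (fun q => P q v) p :=
  ((ContinuousLinearMap.apply ℂ C4 v).restrictScalars ℝ).contDiff.comp_contMDiffAt hP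

/-- A smooth section of a smooth family of subspaces through `v`, obtained by projection of the
constant `v`. -/
lemma SmoothFamily.exists_section {W : M → Submodule ℂ C4} (hW : SmoothFamily W) {p : M} {v : C4}
    (hv : v ∈ W p) : ∃ x : M → C4,
      ContMDiff 𝓘(ℝ, ℂ) 𝓘(ℝ, C4) ∞ x ∧ x p = v ∧ ∀ q, x q ∈ W q :=
  ⟨fun q => (W q).starProjection v, fun q => contMDiffAt_apply (hW q) v,
    Submodule.starProjection_eq_self_iff.2 hv, fun _ => Submodule.starProjection_apply_mem _ _⟩

lemma SmoothMap.exists_section {X : M → CP3} (hX : SmoothMap X) {p : M} {v : C4}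
    (hv : v ∈ (X p).submodule) : ∃ x : M → C4,
      ContMDiff 𝓘(ℝ, ℂ) 𝓘(ℝ, C4) ∞ x ∧ x p = v ∧ ∀ q, x q ∈ (X q).submodule :=
  SmoothFamily.exists_section hX hv

lemma SmoothMap.exists_isSectionAt {X : M → CP3} (hX : SmoothMap X) (p : M) :
    ∃ x : M → C4, IsSectionAt X p x := by
  obtain ⟨v, hv, hv0⟩ := exists_mem_ne_zero (X p)
  obtain ⟨x, hx, rfl, hmem⟩ := hX.exists_section hv
  exact ⟨x, (hx p).mdifferentiableAt (by simp), hv0, Filter.Eventually.of_forall hmem⟩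

lemma SmoothFamily.of_section {W : M → Submodule ℂ C4}
    (h : ∀ p, ∃ x : M → C4, ContMDiffAt 𝓘(ℝ, ℂ) 𝓘(ℝ, C4) ∞ x p ∧ x p ≠ 0 ∧
      ∀ᶠ q in nhds p, W q = Submodule.span ℂ {x q}) : SmoothFamily W := by
  intro p
  obtain ⟨x, hx, hx0, hW⟩ := h p
  have h₁ := (contDiffAt_starProjection_span hx0).comp_contMDiffAt hx
  refine h₁.congr_of_eventuallyEq ?_
  filter_upwards [hW] with q hq
  simp [hq]

lemma contMDiffAt_jMul {a : M → C4} {p : M} (ha : ContMDiffAt 𝓘(ℝ, ℂ) 𝓘(ℝ, C4) ∞ a p) :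
    ContMDiffAt 𝓘(ℝ, ℂ) 𝓘(ℝ, C4) ∞ (fun q => jMul (a q)) p :=
  jMulReal.contDiff.comp_contMDiffAt ha

omit [ChartedSpace ℂ M] in
lemma eventually_ne_zero {x : M → C4} {p : M} (h : ContinuousAt x p) (h0 : x p ≠ 0) :
    ∀ᶠ q in nhds p, x q ≠ 0 := h.eventually_ne h0

lemma SmoothMap.map_jMul {X : M → CP3} (hX : SmoothMap X) :
    SmoothFamily fun q => (X q).submodule.map jMul := by
  refine SmoothFamily.of_section fun p => ?_
  obtain ⟨v, hv, hv0⟩ := exists_mem_ne_zero (X p)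
  obtain ⟨x, hx, rfl, hmem⟩ := hX.exists_section hv
  refine ⟨fun q => jMul (x q), contMDiffAt_jMul (hx p), jMul_ne_zero hv0, ?_⟩
  filter_upwards [eventually_ne_zero (hx p).continuousAt hv0] with q hq
  exact map_jMul_eq_span (hmem q) hq

lemma SmoothMap.of_map_jMul {X : M → CP3}
    (hX : SmoothFamily fun q => (X q).submodule.map jMul) : SmoothMap X := by
  refine SmoothFamily.of_section fun p => ?_
  obtain ⟨v, hv, hv0⟩ := exists_mem_ne_zero (X p)
  obtain ⟨x, hx, hxp, hmem⟩ := SmoothFamily.exists_section hX (p := p) ⟨v, hv, rfl⟩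
  have h0 : jMul (x p) ≠ 0 := by rw [hxp]; exact jMul_ne_zero (jMul_ne_zero hv0)
  refine ⟨fun q => jMul (x q), contMDiffAt_jMul (hx p), h0, ?_⟩
  filter_upwards [eventually_ne_zero (contMDiffAt_jMul (hx p)).continuousAt h0] with q hq
  refine submodule_eq_span ?_ hq
  rw [← map_jMul_map_jMul (X q).submodule]
  exact ⟨_, hmem q, rfl⟩

/-- This is the Leibniz rule for `P x = x`. -/
lemma surfaceDeriv_of_apply_eq {P : M → C4 →L[ℂ] C4} {x : M → C4} {p : M}
    (hP : MDifferentiableAt 𝓘(ℝ, ℂ) 𝓘(ℝ, C4 →L[ℂ] C4) P p)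
    (hx : MDifferentiableAt 𝓘(ℝ, ℂ) 𝓘(ℝ, C4) x p) (h : ∀ᶠ q in nhds p, P q (x q) = x q) (u : ℂ) :
    P p (surfaceDeriv x p u) + surfaceDeriv P p u (x p) = surfaceDeriv x p u := by
  have h₁ := (ContinuousLinearMap.restrictScalarsL ℂ C4 C4 ℝ ℝ).hasFDerivAt.comp _
    (hasFDerivAt_chart hP)
  have h₂ := h₁.clm_apply (hasFDerivAt_chart hx)
  have h₃ := h₂.congr_of_eventuallyEq (f₁ := x ∘ (chartAt ℂ p).symm)
    ((eventually_chart h).mono fun z hz => hz.symm)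
  have h₅ := DFunLike.congr_fun (h₃.unique (hasFDerivAt_chart hx)) u
  simp only [add_apply, ContinuousLinearMap.comp_apply,
    ContinuousLinearMap.flip_apply, Function.comp_apply, chart_symm_apply_chart] at h₅
  exact h₅

/-- The differential of `X`, evaluated on a section. -/
lemma differential_section {X : M → CP3} {p : M} {x : M → C4} (hX : SmoothMap X)
    (hx : IsSectionAt X p x) (u : ℂ) : (differential X p u ⟨x p, hx.mem⟩ : C4) =
      (X p).submoduleᗮ.starProjection (surfaceDeriv x p u) := by
  have hP : MDifferentiableAt 𝓘(ℝ, ℂ) 𝓘(ℝ, C4 →L[ℂ] C4)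
    (fun q => (X q).submodule.starProjection) p := (hX p).mdifferentiableAt (by simp)
  have h₆ : (X p).submodule.starProjection (surfaceDeriv x p u) +
      (projectionDeriv X p u) (x p) = surfaceDeriv x p u :=
    surfaceDeriv_of_apply_eq hP hx.mdifferentiableAt (hx.eventually_mem.mono
      fun q hq => Submodule.starProjection_eq_self_iff.2 hq) u
  have h₇ : (projectionDeriv X p u) (x p) =
      (X p).submoduleᗮ.starProjection (surfaceDeriv x p u) := by
    rw [Submodule.starProjection_orthogonal_val, ← eq_sub_iff_add_eq'.2 h₆]
  have h₈ : (differential X p u ⟨x p, hx.mem⟩ : C4) =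
      (X p).submoduleᗮ.starProjection ((projectionDeriv X p u) (x p)) := rfl
  rw [h₈, h₇]
  exact Submodule.starProjection_eq_self_iff.2 (Submodule.starProjection_apply_mem _ _)

lemma inner_differential_section {X : M → CP3} {p : M} {x : M → C4} (hX : SmoothMap X)
    (hx : IsSectionAt X p x) {w : C4} (hw : ⟪x p, w⟫_ℂ = 0) (u : ℂ) :
    ⟪w, (differential X p u ⟨x p, hx.mem⟩ : C4)⟫_ℂ = ⟪w, surfaceDeriv x p u⟫_ℂ := by
  have hw' : w ∈ (X p).submoduleᗮ := by
    rw [submodule_eq_span hx.mem hx.ne_zero,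
      Submodule.mem_orthogonal_singleton_iff_inner_right]
    exact hw
  rw [differential_section hX hx, ← Submodule.inner_starProjection_left_eq_right,
    Submodule.starProjection_eq_self_iff.2 hw']

/-! ### Smooth maps to the flag manifold -/

/-- `X` and `Y` are the components of a smooth map to the flag manifold. -/
structure IsFlagPair (X Y : M → CP3) : Prop where
  smooth₁ : SmoothMap X
  smooth₂ : SmoothMap Y
  orthogonal : ∀ p, LineOrthogonal (X p) (Y p)

lemma IsFlagPair.symm {X Y : M → CP3} (h : IsFlagPair X Y) : IsFlagPair Y X :=
  ⟨h.smooth₂, h.smooth₁, fun p => (h.orthogonal p).symm⟩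

lemma IsFlagPair.isHorizontalLineBundle {X Y : M → CP3} (h : IsFlagPair X Y) :
    IsHorizontalLineBundle X fun p => tangentLine (X p) (Y p) where
  horizontal p := tangentLine_le (h.orthogonal p)
  rank_one p := finrank_tangentLine (h.orthogonal p)
  smooth := by
    simp only [fun p => tensorLine_tangentLine (h.orthogonal p)]
    exact h.smooth₂.map_jMul

/-- The values of `L p` span the line `Y p j`. Smoothness of `L` is smoothness of these lines, which
transfers to `Y` by another multiplication by `j`. -/
lemma IsHorizontalLineBundle.exists_flagPair {X : M → CP3} (hX : SmoothMap X)
    {L : ∀ p, Submodule ℂ (TangentAt (X p))} (hL : IsHorizontalLineBundle X L) :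
    ∃ Y, IsFlagPair X Y ∧ L = fun p => tangentLine (X p) (Y p) := by
  choose Y hY hLY using fun p => exists_eq_tangentLine (hL.horizontal p) (hL.rank_one p)
  refine ⟨Y, ⟨hX, SmoothMap.of_map_jMul ?_, hY⟩, funext hLY⟩
  have := hL.smooth
  simp only [fun p => hLY p, fun p => tensorLine_tangentLine (hY p)] at this
  exact this

/-! ### First-order conditions on a flag pair, expressed in local sections -/

section Sections

variable {X Y : M → CP3} {p : M} {x y : M → C4}

lemma IsFlagPair.eventually_quatOrthogonal (h : IsFlagPair X Y) (hx : IsSectionAt X p x)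
    (hy : IsSectionAt Y p y) : ∀ᶠ q in nhds p, QuatOrthogonal (x q) (y q) := by
  filter_upwards [hx.eventually_mem, hy.eventually_mem] with q h₁ h₂
  exact h.orthogonal q _ h₁ _ h₂

/-- Differentiating `⟪x, y⟫ = 0` exchanges the tangency condition for `X` with one of the two
tangency conditions for `Y`. -/
lemma IsFlagPair.inner_eq_zero_iff (h : IsFlagPair X Y) (hx : IsSectionAt X p x)
    (hy : IsSectionAt Y p y) (u : ℂ) :
    ⟪x p, surfaceDeriv y p u⟫_ℂ = 0 ↔ ⟪y p, surfaceDeriv x p u⟫_ℂ = 0 := by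
  have := inner_surfaceDeriv_add hx.mdifferentiableAt hy.mdifferentiableAt
    ((h.eventually_quatOrthogonal hx hy).mono fun _ hq => hq.1) u
  rw [inner_eq_zero_symm (x := y p)]
  constructor
  · intro e
    rwa [e, zero_add] at this
  · intro e
    rwa [e, add_zero] at this

/-- This common component is the only one that survives in `dY`, and it carries all of `𝐈₁`. -/
lemma IsFlagPair.inner_jMul_eq (h : IsFlagPair X Y) (hx : IsSectionAt X p x)
    (hy : IsSectionAt Y p y) (u : ℂ) :
    ⟪jMul (x p), surfaceDeriv y p u⟫_ℂ = ⟪jMul (y p), surfaceDeriv x p u⟫_ℂ :=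
  jMul_surfaceDeriv_add hx.mdifferentiableAt hy.mdifferentiableAt
    ((h.eventually_quatOrthogonal hx hy).mono fun _ hq => hq.2) u

lemma IsFlagPair.quatOrthogonal (h : IsFlagPair X Y) (hx : IsSectionAt X p x)
    (hy : IsSectionAt Y p y) : QuatOrthogonal (x p) (y p) :=
  h.orthogonal p _ hx.mem _ hy.mem

lemma IsFlagPair.inner_differential (h : IsFlagPair X Y) (hx : IsSectionAt X p x)
    (hy : IsSectionAt Y p y) (u : ℂ) :
    ⟪y p, (differential X p u ⟨x p, hx.mem⟩ : C4)⟫_ℂ = ⟪y p, surfaceDeriv x p u⟫_ℂ :=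
  inner_differential_section h.smooth₁ hx (h.quatOrthogonal hx hy).1 u

lemma IsFlagPair.inner_jMul_differential (h : IsFlagPair X Y) (hx : IsSectionAt X p x)
    (hy : IsSectionAt Y p y) (u : ℂ) :
    ⟪jMul (y p), (differential X p u ⟨x p, hx.mem⟩ : C4)⟫_ℂ =
      ⟪jMul (y p), surfaceDeriv x p u⟫_ℂ :=
  inner_differential_section h.smooth₁ hx
    (inner_eq_zero_symm.1 (h.quatOrthogonal hx hy).symm.2) u

lemma inner_jMul_self_differential (hX : SmoothMap X) (hx : IsSectionAt X p x) (u : ℂ) :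
    ⟪jMul (x p), (differential X p u ⟨x p, hx.mem⟩ : C4)⟫_ℂ =
      ⟪jMul (x p), surfaceDeriv x p u⟫_ℂ :=
  inner_differential_section hX hx (inner_self_jMul _) u

lemma IsFlagPair.mem_quatLine_orthogonal (h : IsFlagPair X Y) (hx : IsSectionAt X p x)
    (hy : IsSectionAt Y p y) : y p ∈ (quatLine (X p))ᗮ ∧ jMul (y p) ∈ (quatLine (X p))ᗮ := by
  have hxy := h.quatOrthogonal hx hy
  rw [NearlyKahler.mem_quatLine_orthogonal hx.mem hx.ne_zero,
    NearlyKahler.mem_quatLine_orthogonal hx.mem hx.ne_zero]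
  exact ⟨hxy, inner_eq_zero_symm.1 hxy.symm.2, by rw [inner_jMul_jMul]; exact hxy.symm.1⟩

lemma formI₁_apply (u : ℂ) : formI₁ X p u = horPart (X p) (differential X p u) := rfl

/-- Only the `y` component has to vanish, because passing to the horizontal part already discards
the `x j` component. For the full differential, `IsFlagPair.differential_mem_iff` needs both
conditions. -/
lemma IsFlagPair.formI₁_mem_iff (h : IsFlagPair X Y) (hx : IsSectionAt X p x)
    (hy : IsSectionAt Y p y) (u : ℂ) :
    formI₁ X p u ∈ tangentLine (X p) (Y p) ↔ ⟪y p, surfaceDeriv x p u⟫_ℂ = 0 := by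
  rw [mem_tangentLine_iff hx.mem hx.ne_zero hy.mem hy.ne_zero (h.orthogonal p), formI₁_apply,
    inner_horPart (h.mem_quatLine_orthogonal hx hy).1, h.inner_differential hx hy]
  exact and_iff_right (horPart_mem_horizontalSpace _)

lemma IsFlagPair.differential_mem_iff (h : IsFlagPair X Y) (hx : IsSectionAt X p x)
    (hy : IsSectionAt Y p y) (u : ℂ) :
    differential X p u ∈ tangentLine (X p) (Y p) ↔
      ⟪jMul (x p), surfaceDeriv x p u⟫_ℂ = 0 ∧ ⟪y p, surfaceDeriv x p u⟫_ℂ = 0 := by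
  rw [mem_tangentLine_iff hx.mem hx.ne_zero hy.mem hy.ne_zero (h.orthogonal p),
    mem_horizontalSpace_iff hx.mem hx.ne_zero, inner_jMul_self_differential h.smooth₁ hx,
    h.inner_differential hx hy]

lemma IsFlagPair.eq_zero_of_mem (h : IsFlagPair X Y) (hx : IsSectionAt X p x)
    (hy : IsSectionAt Y p y) {A : TangentAt (X p)} (hA : A ∈ tangentLine (X p) (Y p)) :
    A = 0 ↔ ⟪jMul (y p), (A ⟨x p, hx.mem⟩ : C4)⟫_ℂ = 0 := by
  constructor
  · rintro rfl
    simp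
  · intro hA0
    have hA' := (mem_tangentLine_iff hx.mem hx.ne_zero hy.mem hy.ne_zero (h.orthogonal p)).1 hA
    apply tangent_ext hx.mem hx.ne_zero
    exact eq_zero_of_inner_eq_zero hx.ne_zero hy.ne_zero (h.quatOrthogonal hx hy)
      (inner_tangent hx.mem _ _) ((mem_horizontalSpace_iff hx.mem hx.ne_zero).1 hA'.1) hA'.2 hA0

/-- The horizontal part of `dX` and the differential of `Y` have the same zeros. -/
lemma IsFlagPair.formI₁_eq_zero_iff (h : IsFlagPair X Y) {u : ℂ}
    (hX : formI₁ X p u ∈ tangentLine (X p) (Y p))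
    (hY : differential Y p u ∈ tangentLine (Y p) (X p)) :
    formI₁ X p u = 0 ↔ differential Y p u = 0 := by
  obtain ⟨x, hx⟩ := h.smooth₁.exists_isSectionAt p
  obtain ⟨y, hy⟩ := h.smooth₂.exists_isSectionAt p
  rw [h.eq_zero_of_mem hx hy hX, h.symm.eq_zero_of_mem hy hx hY, formI₁_apply,
    inner_horPart (h.mem_quatLine_orthogonal hx hy).2, h.inner_jMul_differential hx hy,
    h.symm.inner_jMul_differential hy hx, h.inner_jMul_eq hx hy]

end Sections

/-! ### From null-torsion curves to contact curves -/

lemma contDiffAt_normalize {v : C4} (hv : v ≠ 0) :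
    ContDiffAt ℝ ∞ (fun v : C4 => ‖v‖⁻¹ • v) v :=
  ((contDiffAt_norm ℂ hv).inv (norm_ne_zero_iff.2 hv)).smul contDiffAt_id

lemma SmoothMap.exists_unit_section {X : M → CP3} (hX : SmoothMap X) (p : M) :
    ∃ (U : Set M) (x : M → C4), IsOpen U ∧ p ∈ U ∧ ContMDiffOn 𝓘(ℝ, ℂ) 𝓘(ℝ, C4) ∞ x U ∧
      (∀ q ∈ U, ‖x q‖ = 1) ∧ ∀ q ∈ U, x q ∈ (X q).submodule := by
  obtain ⟨v, hv, hv0⟩ := exists_mem_ne_zero (X p)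
  obtain ⟨x, hx, hxp, hxmem⟩ := hX.exists_section hv
  refine ⟨{q | x q ≠ 0}, fun q => ‖x q‖⁻¹ • x q, isOpen_ne_fun hx.continuous continuous_const,
    by rwa [Set.mem_ofPred_eq, hxp], fun q hq => ?_, fun q hq => ?_, fun q _ => ?_⟩
  · exact ((contDiffAt_normalize hq).comp_contMDiffAt (hx q)).contMDiffWithinAt
  · rw [norm_smul, norm_inv, norm_norm, inv_mul_cancel₀ (norm_ne_zero_iff.2 hq)]
  · change ‖x q‖⁻¹ • x q ∈ _
    rw [← Complex.coe_smul]
    exact Submodule.smul_mem _ _ (hxmem q)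

lemma kappa12_eq_zero_iff {y : M → C4} {p : M} {u : ℂ} :
    kappa12 y p u = 0 ↔ ⟪jMul (y p), surfaceDeriv y p u⟫_ℂ = 0 := by
  change -starRingEnd ℂ ⟪jMul (y p), surfaceDeriv y p u⟫_ℂ = 0 ↔ _
  rw [neg_eq_zero, map_eq_zero]

/-- If `𝐈𝐈 = 0`, then there are sections of `Y` along which the contact form vanishes. -/
lemma IsFlagPair.exists_section_of_formIIVanishes {X Y : M → CP3} (h : IsFlagPair X Y)
    (hII : FormIIVanishes X fun p => tangentLine (X p) (Y p)) (p : M) :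
    ∃ y, IsSectionAt Y p y ∧ ∀ u, ⟪jMul (y p), surfaceDeriv y p u⟫_ℂ = 0 := by
  obtain ⟨U, x, hU, hpU, hx, hx1, hxmem⟩ := h.smooth₁.exists_unit_section p
  obtain ⟨V, y, hV, hpV, hy, hy1, hymem⟩ := h.smooth₂.exists_unit_section p
  have hx0 : ∀ q ∈ U, x q ≠ 0 := fun q hq e => by simpa [e] using hx1 q hq
  -- Any unit sections of `X` and `Y` form an adapted frame for `L = Hom(X, Y j)`.
  have hframe : IsAdaptedFrame X (fun p => tangentLine (X p) (Y p)) (U ∩ V) x y :=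
    { isOpen := hU.inter hV
      smooth₁ := hx.mono Set.inter_subset_left
      smooth₂ := hy.mono Set.inter_subset_right
      norm₁ := fun q hq => hx1 q hq.1
      norm₂ := fun q hq => hy1 q hq.2
      orthogonal := fun q hq => h.orthogonal q _ (hxmem q hq.1) _ (hymem q hq.2)
      adapted := fun q hq => ⟨hxmem q hq.1, exists_mem_tangentLine _ (hx0 q hq.1)
        (hymem q hq.2) (h.orthogonal q)⟩ }
  refine ⟨y, ⟨((hy p hpV).contMDiffAt (hV.mem_nhds hpV)).mdifferentiableAt (by simp), ?_, ?_⟩,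
    fun u => ?_⟩
  · intro e
    simpa [e] using hy1 p hpV
  · filter_upwards [hV.mem_nhds hpV] with q hq using hymem q hq
  · exact kappa12_eq_zero_iff.1 (hII _ _ _ hframe p ⟨hpU, hpV⟩ u)

/-- Null torsion kills `⟪y j, dy⟫`, and tangency of `𝐈₁` kills `⟪x, dy⟫`. Modulo `y` only the
direction `x j` is left. -/
lemma IsFlagPair.isContactTangentLine {X Y : M → CP3} (h : IsFlagPair X Y)
    (hX : IsTangentLine X fun p => tangentLine (X p) (Y p))
    (hII : FormIIVanishes X fun p => tangentLine (X p) (Y p)) :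
    IsContactTangentLine Y fun p => tangentLine (Y p) (X p) where
  toIsHorizontalLineBundle := h.symm.isHorizontalLineBundle
  differential_mem p u := by
    obtain ⟨x, hx⟩ := h.smooth₁.exists_isSectionAt p
    obtain ⟨y, hy, hyy⟩ := h.exists_section_of_formIIVanishes hII p
    exact (h.symm.differential_mem_iff hy hx u).2 ⟨hyy u,
      (h.inner_eq_zero_iff hx hy u).2 ((h.formI₁_mem_iff hx hy u).1 (hX.formI₁_mem p u))⟩

lemma differential_eq_zero_of_eventually_const {X : M → CP3} {p : M}
    (h : ∀ᶠ q in nhds p, X q = X p) (u : ℂ) : differential X p u = 0 := by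
  have h₁ : (fun q => (X q).submodule.starProjection) =ᶠ[nhds p]
      fun _ : M => (X p).submodule.starProjection := by
    filter_upwards [h] with q hq
    rw [hq]
  have h₂ : projectionDeriv X p u = 0 := by
    have : mfderiv 𝓘(ℝ, ℂ) 𝓘(ℝ, C4 →L[ℂ] C4) (fun q => (X q).submodule.starProjection) p = 0 := by
      rw [h₁.mfderiv_eq]
      exact mfderiv_const
    exact DFunLike.congr_fun this u
  ext v : 1
  have h₃ : differential X p u v =
    (X p).submoduleᗮ.orthogonalProjectionOnto (projectionDeriv X p u v) := rfl
  rw [h₃, h₂, zero_apply, map_zero]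
  rfl

lemma differential_eq_zero_of_const {X : M → CP3} {ℓ : CP3} (h : ∀ p, X p = ℓ) (p : M) (u : ℂ) :
    differential X p u = 0 :=
  differential_eq_zero_of_eventually_const (Filter.Eventually.of_forall fun q => by rw [h, h]) u

lemma mem_horizontalSpace_iff_forall_contactSystem {ℓ : CP3} {A : TangentAt ℓ} :
    (∀ θ ∈ contactSystem ℓ, θ A = 0) ↔ A ∈ horizontalSpace ℓ :=
  Subspace.forall_mem_dualAnnihilator_apply_eq_zero_iff _ _

/-- Since `dY` has values in a line, holomorphy is a condition on the shared component `⟪x j, dy⟫ =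
⟪y j, dx⟫` alone. A constant `Y` would force `𝐈₁` to vanish identically. -/
lemma IsFlagPair.isContactCurve {X Y : M → CP3} (h : IsFlagPair X Y)
    (hX : IsPseudoholomorphicCurve X) (hX0 : ∃ (p : M) (u : ℂ), formI₁ X p u ≠ 0)
    (hXY : IsTangentLine X fun p => tangentLine (X p) (Y p))
    (hYX : IsContactTangentLine Y fun p => tangentLine (Y p) (X p)) : IsContactCurve Y where
  holomorphic :=
    { smooth := h.smooth₂
      nonconstant := by
        rintro ⟨ℓ, hℓ⟩
        obtain ⟨p, u, hpu⟩ := hX0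
        exact hpu ((h.formI₁_eq_zero_iff (hXY.formI₁_mem p u) (hYX.differential_mem p u)).2
          (differential_eq_zero_of_const hℓ p u))
      commutes := fun p (u : ℂ) => by
        change differential Y p (Complex.I * u : ℂ) = kahlerJ (Y p) (differential Y p u)
        have hJ : differential X p (Complex.I * u : ℂ) =
          nearlyKahlerJ (X p) (differential X p u) := hX.commutes p u
        obtain ⟨x, hx⟩ := h.smooth₁.exists_isSectionAt p
        obtain ⟨y, hy⟩ := h.smooth₂.exists_isSectionAt p
        have h₁ := hYX.differential_mem p (Complex.I * u : ℂ)
        have h₂ : kahlerJ (Y p) (differential Y p u) ∈ tangentLine (Y p) (X p) :=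
          Submodule.smul_mem _ _ (hYX.differential_mem p u)
        -- The third relation concerns the `y j` component, which is horizontal, so the structure
        -- acts there as `i`.
        have h₃ := ((eq_nearlyKahlerJ_iff hx.mem hx.ne_zero hy.mem hy.ne_zero
          (h.orthogonal p)).1 hJ).2.2
        rw [h.inner_jMul_differential hx hy, h.inner_jMul_differential hx hy,
          ← h.inner_jMul_eq hx hy, ← h.inner_jMul_eq hx hy] at h₃
        rw [← sub_eq_zero, h.symm.eq_zero_of_mem hy hx (Submodule.sub_mem _ h₁ h₂),
          LinearMap.sub_apply, Submodule.coe_sub, inner_sub_right, kahlerJ, LinearMap.smul_apply,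
          Submodule.coe_smul, inner_smul_right, h.symm.inner_jMul_differential hy hx,
          h.symm.inner_jMul_differential hy hx, h₃, sub_self] }
  integral p u θ hθ := mem_horizontalSpace_iff_forall_contactSystem.2
    (tangentLine_le (h.symm.orthogonal p) (hYX.differential_mem p u)) θ hθ

/-! ### From contact curves to null-torsion curves -/

lemma IsFlagPair.isTangentLine {X Y : M → CP3} (h : IsFlagPair X Y)
    (hYX : IsContactTangentLine Y fun p => tangentLine (Y p) (X p)) :
    IsTangentLine X fun p => tangentLine (X p) (Y p) where
  toIsHorizontalLineBundle := h.isHorizontalLineBundle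
  formI₁_mem p u := by
    obtain ⟨x, hx⟩ := h.smooth₁.exists_isSectionAt p
    obtain ⟨y, hy⟩ := h.smooth₂.exists_isSectionAt p
    exact (h.formI₁_mem_iff hx hy u).2 ((h.inner_eq_zero_iff hx hy u).1
      ((h.symm.differential_mem_iff hy hx u).1 (hYX.differential_mem p u)).2)

/-- In an arbitrary adapted frame, `e₂ j` lies in `Y j`, so `e₂` is a section of `Y`. Horizontality
of `dY` then gives `⟪e₂ j, de₂⟫ = 0`. -/
lemma IsFlagPair.formIIVanishes {X Y : M → CP3} (h : IsFlagPair X Y)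
    (hYX : IsContactTangentLine Y fun p => tangentLine (Y p) (X p)) :
    FormIIVanishes X fun p => tangentLine (X p) (Y p) := by
  intro U e₁ e₂ hf p hp u
  have hU := hf.isOpen.mem_nhds hp
  have hy : IsSectionAt Y p e₂ :=
    { mdifferentiableAt := ((hf.smooth₂ p hp).contMDiffAt hU).mdifferentiableAt (by simp)
      ne_zero := fun e => by simpa [e] using hf.norm₂ p hp
      eventually_mem := by
        filter_upwards [hU] with q hq
        obtain ⟨hm, A, hA, hAe⟩ := hf.adapted q hq
        have h₁ := hA ⟨e₁ q, hm⟩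
        rw [hAe] at h₁
        have e : e₂ q = -jMul (jMul (e₂ q)) := by rw [jMul_jMul, neg_neg]
        rw [← map_jMul_map_jMul (Y q).submodule, e]
        exact Submodule.neg_mem _ (Submodule.mem_map_of_mem h₁) }
  obtain ⟨x, hx⟩ := h.smooth₁.exists_isSectionAt p
  exact kappa12_eq_zero_iff.2
    ((h.symm.differential_mem_iff hy hx u).1 (hYX.differential_mem p u)).1

/-- The `y` component of `dX` vanishes and the `y j` component is shared with `dY`. The `x j`
component is not visible in `dY`; its antilinearity is the assumption `hvert`, supplied by
`exists_local_partner`. -/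
lemma IsFlagPair.isNullTorsionCurve {X Y : M → CP3} (h : IsFlagPair X Y) (hY : IsContactCurve Y)
    (hY0 : ∃ (p : M) (u : ℂ), differential Y p u ≠ 0)
    (hYX : IsContactTangentLine Y fun p => tangentLine (Y p) (X p))
    (hvert : ∀ p, ∃ x, IsSectionAt X p x ∧ ∀ u : ℂ, ⟪jMul (x p), surfaceDeriv x p (Complex.I * u)⟫_ℂ
      = -(Complex.I * ⟪jMul (x p), surfaceDeriv x p u⟫_ℂ)) : IsNullTorsionCurve X := by
  have hXY := h.isTangentLine hYX
  have hX0 : ∃ (p : M) (u : ℂ), formI₁ X p u ≠ 0 := by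
    obtain ⟨p, u, hpu⟩ := hY0
    exact ⟨p, u, fun e => hpu ((h.formI₁_eq_zero_iff (hXY.formI₁_mem p u)
      (hYX.differential_mem p u)).1 e)⟩
  refine ⟨⟨h.smooth₁, ?_, fun p (u : ℂ) => ?_⟩, hX0, _, hXY, h.formIIVanishes hYX⟩
  · rintro ⟨ℓ, hℓ⟩
    obtain ⟨p, u, hpu⟩ := hX0
    apply hpu
    rw [formI₁_apply, differential_eq_zero_of_const hℓ p u, map_zero]
  · obtain ⟨x, hx, hxx⟩ := hvert p
    obtain ⟨y, hy⟩ := h.smooth₂.exists_isSectionAt p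
    have h₀ : ∀ u : ℂ, ⟪y p, surfaceDeriv x p u⟫_ℂ = 0 := fun u =>
      (h.formI₁_mem_iff hx hy u).1 (hXY.formI₁_mem p u)
    have hJ : differential Y p (Complex.I * u : ℂ) = kahlerJ (Y p) (differential Y p u) :=
      hY.holomorphic.commutes p u
    change differential X p (Complex.I * u : ℂ) = nearlyKahlerJ (X p) (differential X p u)
    rw [eq_nearlyKahlerJ_iff hx.mem hx.ne_zero hy.mem hy.ne_zero (h.orthogonal p),
      inner_jMul_self_differential h.smooth₁ hx, inner_jMul_self_differential h.smooth₁ hx,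
      h.inner_differential hx hy, h.inner_differential hx hy, h.inner_jMul_differential hx hy,
      h.inner_jMul_differential hx hy, h₀, h₀, mul_zero]
    refine ⟨hxx u, rfl, ?_⟩
    rw [← h.inner_jMul_eq hx hy, ← h.inner_jMul_eq hx hy, ← h.symm.inner_jMul_differential hy hx,
      ← h.symm.inner_jMul_differential hy hx, hJ, kahlerJ,
      LinearMap.smul_apply, Submodule.coe_smul, inner_smul_right]

/-! ### Holomorphic lifts -/

lemma differentiableAt_chart_change [IsManifold 𝓘(ℂ) ω M] {p q r : M}
    (hp : q ∈ (chartAt ℂ p).source) (hr : q ∈ (chartAt ℂ r).source) :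
    DifferentiableAt ℂ (chartAt ℂ r ∘ (chartAt ℂ p).symm) (chartAt ℂ p q) := by
  have h := contDiffWithinAt_ext_coord_change (I := 𝓘(ℂ)) (n := ω) r p
    (y := chartAt ℂ p q) (by
      rw [ext_coord_change_source]
      exact ⟨chartAt ℂ p q, ⟨(chartAt ℂ p).map_source hp, by
        change (chartAt ℂ p).symm (chartAt ℂ p q) ∈ (chartAt ℂ r).source
        rwa [(chartAt ℂ p).left_inv hp]⟩, rfl⟩)
  have h' : ContDiffWithinAt ℂ ω (chartAt ℂ r ∘ (chartAt ℂ p).symm) Set.univ (chartAt ℂ p q) := by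
    rw [← Set.range_id]; exact h
  exact (contDiffWithinAt_univ.1 h').differentiableAt (by simp)

/-- `surfaceDeriv` at `q` is taken in the preferred chart at `q`, while holomorphy near `p` must be
tested in the single chart at `p`. The two differ by the factor `c`, which is nonzero because the
inverse chart change is also differentiable. -/
lemma exists_hasDerivAt_chart_change [IsManifold 𝓘(ℂ) ω M] {p q : M}
    (hp : q ∈ (chartAt ℂ p).source) : ∃ c : ℂ, c ≠ 0 ∧
      HasDerivAt (chartAt ℂ q ∘ (chartAt ℂ p).symm) c (chartAt ℂ p q) := by
  have hq := mem_chart_source ℂ q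
  have h₁ := (differentiableAt_chart_change hp hq).hasDerivAt
  have h₂ := (differentiableAt_chart_change hq hp).hasDerivAt
  refine ⟨_, fun e => ?_, h₁⟩
  have e₁ : (chartAt ℂ q ∘ (chartAt ℂ p).symm) (chartAt ℂ p q) = chartAt ℂ q q := by
    rw [Function.comp_apply, (chartAt ℂ p).left_inv hp]
  have h₃ := HasDerivAt.scomp_of_eq (chartAt ℂ p q) h₂ h₁ e₁.symm
  have h₄ : ((chartAt ℂ p ∘ (chartAt ℂ q).symm) ∘ (chartAt ℂ q ∘ (chartAt ℂ p).symm))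
      =ᶠ[nhds (chartAt ℂ p q)] id := by
    have t₁ := (chartAt ℂ p).open_target.mem_nhds ((chartAt ℂ p).map_source hp)
    have t₂ := ((chartAt ℂ p).tendsto_symm hp).eventually ((chartAt ℂ q).open_source.mem_nhds hq)
    filter_upwards [t₁, t₂] with z hz hz'
    simp only [Function.comp_apply, id]
    rw [(chartAt ℂ q).left_inv hz', (chartAt ℂ p).right_inv hz]
  have h₅ := h₃.unique ((hasDerivAt_id _).congr_of_eventuallyEq h₄)
  rw [e, zero_smul] at h₅
  exact zero_ne_one h₅

lemma hasFDerivAt_chart_of_mem [IsManifold 𝓘(ℂ) ω M] {p q : M}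
    (hp : q ∈ (chartAt ℂ p).source) {f : M → C4}
    (hf : MDifferentiableAt 𝓘(ℝ, ℂ) 𝓘(ℝ, C4) f q) : ∃ c : ℂ, c ≠ 0 ∧
      HasFDerivAt (f ∘ (chartAt ℂ p).symm)
        (surfaceDeriv f q ∘L (c • (1 : ℂ →L[ℂ] ℂ)).restrictScalars ℝ) (chartAt ℂ p q) := by
  obtain ⟨c, hc, h⟩ := exists_hasDerivAt_chart_change hp
  refine ⟨c, hc, ?_⟩
  have hq := mem_chart_source ℂ q
  have e₁ : (chartAt ℂ q ∘ (chartAt ℂ p).symm) (chartAt ℂ p q) = chartAt ℂ q q := by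
    rw [Function.comp_apply, (chartAt ℂ p).left_inv hp]
  have h₁ := h.hasFDerivAt.restrictScalars ℝ
  have h₂ := hasFDerivAt_chart hf
  rw [← e₁] at h₂
  have h₃ := (h₂.comp (chartAt ℂ p q) h₁)
  have e₂ : (c • (1 : ℂ →L[ℂ] ℂ)) = ContinuousLinearMap.toSpanSingleton ℂ c := by
    ext; simp
  rw [e₂]
  refine h₃.congr_of_eventuallyEq ?_
  have t₂ := ((chartAt ℂ p).tendsto_symm hp).eventually ((chartAt ℂ q).open_source.mem_nhds hq)
  filter_upwards [t₂] with z hz'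
  simp only [Function.comp_apply]
  rw [(chartAt ℂ q).left_inv hz']

lemma apply_eq_smul_of_commutes {T : ℂ →L[ℝ] C4}
    (h : ∀ u, T (Complex.I * u) = Complex.I • T u) (u : ℂ) : T u = u • T 1 := by
  have e : u = u.re • (1 : ℂ) + u.im • (Complex.I * 1) := by
    rw [mul_one, Complex.real_smul, Complex.real_smul, mul_one, Complex.re_add_im]
  conv_lhs => rw [e]
  rw [map_add, map_smul, map_smul, h]
  conv_rhs => rw [← Complex.re_add_im u]
  rw [add_smul, mul_smul, Complex.coe_smul, Complex.coe_smul]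

/-- A function on the surface with complex linear derivative is holomorphic in the chart. -/
lemma hasDerivAt_of_commutes [IsManifold 𝓘(ℂ) ω M] {s : M → C4} {p q : M}
    (hp : q ∈ (chartAt ℂ p).source) (hs : MDifferentiableAt 𝓘(ℝ, ℂ) 𝓘(ℝ, C4) s q)
    (h : ∀ u, surfaceDeriv s q (Complex.I * u) = Complex.I • surfaceDeriv s q u) :
    ∃ c : ℂ, c ≠ 0 ∧ HasDerivAt (s ∘ (chartAt ℂ p).symm) (c • surfaceDeriv s q 1)
      (chartAt ℂ p q) := by
  obtain ⟨c, hc, h₁⟩ := hasFDerivAt_chart_of_mem hp hs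
  refine ⟨c, hc, hasDerivAt_iff_hasFDerivAt.2 (hasFDerivAt_of_restrictScalars ℝ h₁ ?_)⟩
  ext1 u
  have := apply_eq_smul_of_commutes h (c * u)
  simp only [ContinuousLinearMap.coe_restrictScalars', ContinuousLinearMap.toSpanSingleton_apply,
    ContinuousLinearMap.comp_apply, smul_apply, one_apply_eq_self, smul_eq_mul, this,
    smul_smul, mul_comm]

lemma analyticAt_of_commutes [IsManifold 𝓘(ℂ) ω M] {s : M → C4} {p : M}
    (h : ∀ᶠ q in nhds p, MDifferentiableAt 𝓘(ℝ, ℂ) 𝓘(ℝ, C4) s q ∧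
      ∀ u, surfaceDeriv s q (Complex.I * u) = Complex.I • surfaceDeriv s q u) :
    AnalyticAt ℂ (s ∘ (chartAt ℂ p).symm) (chartAt ℂ p p) := by
  have hp := mem_chart_source ℂ p
  have h₁ : ∀ᶠ z in nhds (chartAt ℂ p p), DifferentiableAt ℂ (s ∘ (chartAt ℂ p).symm) z := by
    filter_upwards [eventually_chart h,
      (chartAt ℂ p).open_target.mem_nhds ((chartAt ℂ p).map_source hp)] with z hz hz'
    obtain ⟨c, -, hd⟩ := hasDerivAt_of_commutes ((chartAt ℂ p).map_target hz') hz.1 hz.2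
    rw [(chartAt ℂ p).right_inv hz'] at hd
    exact hd.differentiableAt
  exact Complex.analyticAt_iff_eventually_differentiableAt.2 h₁

lemma contMDiffAt_comp_chart {g : ℂ → C4} {p : M} (hg : AnalyticAt ℂ g (chartAt ℂ p p)) :
    ContMDiffAt 𝓘(ℝ, ℂ) 𝓘(ℝ, C4) ∞ (fun q => g (chartAt ℂ p q)) p := by
  have hp := mem_chart_source ℂ p
  refine contMDiffAt_iff.2 ⟨ContinuousAt.comp (f := chartAt ℂ p) hg.continuousAt
    ((chartAt ℂ p).continuousAt hp), ?_⟩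
  have h₁ : ContDiffAt ℝ ∞ g (chartAt ℂ p p) := hg.contDiffAt.restrict_scalars ℝ
  refine ContDiffAt.contDiffWithinAt (h₁.congr_of_eventuallyEq ?_)
  filter_upwards [(chartAt ℂ p).open_target.mem_nhds ((chartAt ℂ p).map_source hp)] with z hz
  change g (chartAt ℂ p ((chartAt ℂ p).symm z)) = g z
  rw [(chartAt ℂ p).right_inv hz]

lemma surfaceDeriv_comp_chart {g : ℂ → C4} {p : M} (hg : AnalyticAt ℂ g (chartAt ℂ p p)) (u : ℂ) :
    surfaceDeriv (fun q => g (chartAt ℂ p q)) p u = u • deriv g (chartAt ℂ p p) := by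
  have hp := mem_chart_source ℂ p
  have h₁ := hg.differentiableAt.hasDerivAt.hasFDerivAt.restrictScalars ℝ
  rw [surfaceDeriv_eq ((contMDiffAt_comp_chart hg).mdifferentiableAt (by simp))
    (h₁.congr_of_eventuallyEq ?_)]
  · simp
  · filter_upwards [(chartAt ℂ p).open_target.mem_nhds ((chartAt ℂ p).map_source hp)] with z hz
    change g (chartAt ℂ p ((chartAt ℂ p).symm z)) = g z
    rw [(chartAt ℂ p).right_inv hz]

/-- A holomorphic lift `s` of `Y` near `p`, in the affine hyperplane `⟪v, s⟫ = 1`. -/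
structure IsHolomorphicLift (Y : M → CP3) (v : C4) (s : M → C4) (q : M) : Prop where
  section_at : IsSectionAt Y q s
  commutes : ∀ u, surfaceDeriv s q (Complex.I * u) = Complex.I • surfaceDeriv s q u
  inner_eq : ⟪v, s q⟫_ℂ = 1
  inner_deriv : ∀ u, ⟪v, surfaceDeriv s q u⟫_ℂ = 0

/-- If `dY` vanishes on `u`, then `ds(u)` is a multiple of `s`; pairing with `v`, where `⟪v, s⟫ = 1`
and `⟪v, ds⟫ = 0`, shows that the multiple is zero. -/
lemma IsHolomorphicLift.differential_eq_zero_iff {Y : M → CP3} {v : C4} {s : M → C4} {q : M}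
    (hY : SmoothMap Y) (h : IsHolomorphicLift Y v s q) (u : ℂ) :
    differential Y q u = 0 ↔ surfaceDeriv s q u = 0 := by
  have hs := h.section_at
  constructor
  · intro e
    have h₁ := differential_section hY hs u
    rw [e] at h₁
    have h₂ : surfaceDeriv s q u ∈ (Y q).submodule := by
      rw [← (Y q).submodule.orthogonal_orthogonal]
      exact (Submodule.starProjection_apply_eq_zero_iff _).1 h₁.symm
    obtain ⟨c, hc⟩ := Submodule.mem_span_singleton.1 (submodule_eq_span hs.mem hs.ne_zero ▸ h₂)
    have h₃ := h.inner_deriv u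
    rw [← hc, inner_smul_right, h.inner_eq, mul_one] at h₃
    rw [← hc, h₃, zero_smul]
  · intro e
    apply tangent_ext hs.mem hs.ne_zero
    rw [differential_section hY hs u, e, map_zero]
    rfl

lemma surfaceDeriv_const (v : C4) (p : M) (u : ℂ) :
    surfaceDeriv (fun _ : M => v) p u = 0 := by
  have : surfaceDeriv (fun _ : M => v) p = 0 :=
    surfaceDeriv_eq mdifferentiableAt_const (hasFDerivAt_const v _)
  rw [this, zero_apply]

/-- Complex linearity of `dY` makes `ds` complex linear modulo `s`. The affine normalization `⟪v, s⟫
= 1` removes the ambiguity. -/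
lemma exists_holomorphicLift {Y : M → CP3} (hY : IsJCurve kahlerJ Y) (p : M) :
    ∃ (v : C4) (s : M → C4), ContMDiffAt 𝓘(ℝ, ℂ) 𝓘(ℝ, C4) ∞ s p ∧
      ∀ᶠ q in nhds p, IsHolomorphicLift Y v s q := by
  obtain ⟨v, hv, hv0⟩ := exists_mem_ne_zero (Y p)
  obtain ⟨y, hy, hyp, hymem⟩ := hY.smooth.exists_section hv
  -- Because `v` lies in `Y p` and `y p = v`, the denominator at `p` is `⟪v, v⟫`, hence it is
  -- nonzero near `p`.
  set s : M → C4 := fun q => (⟪v, y q⟫_ℂ)⁻¹ • y q with hs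
  have hsmem : ∀ q, s q ∈ (Y q).submodule := fun q => Submodule.smul_mem _ _ (hymem q)
  have hsm : ∀ q, ⟪v, y q⟫_ℂ ≠ 0 → ContMDiffAt 𝓘(ℝ, ℂ) 𝓘(ℝ, C4) ∞ s q := by
    intro q hq
    have : ContDiffAt ℝ ∞ (fun w : C4 => (⟪v, w⟫_ℂ)⁻¹ • w) (y q) :=
      ((contDiffAt_const.inner ℂ contDiffAt_id).inv hq).smul contDiffAt_id
    exact this.comp_contMDiffAt (hy q)
  have hopen : IsOpen {q | ⟪v, y q⟫_ℂ ≠ 0} :=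
    isOpen_ne_fun (continuous_const.inner hy.continuous) continuous_const
  have hp : p ∈ {q | ⟪v, y q⟫_ℂ ≠ 0} := by
    change ⟪v, y p⟫_ℂ ≠ 0
    rw [hyp]
    exact inner_self_ne_zero.2 hv0
  refine ⟨v, s, hsm p hp, ?_⟩
  have hs1 : ∀ q ∈ {q | ⟪v, y q⟫_ℂ ≠ 0}, ⟪v, s q⟫_ℂ = 1 := fun q hq => by
    rw [hs, inner_smul_right, inv_mul_cancel₀ hq]
  filter_upwards [hopen.mem_nhds hp] with q hq
  have hmd := (hsm q hq).mdifferentiableAt (by simp)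
  have hsec : IsSectionAt Y q s := ⟨hmd, fun e => by simpa [e] using hs1 q hq,
    Filter.Eventually.of_forall hsmem⟩
  have hd : ∀ u, ⟪v, surfaceDeriv s q u⟫_ℂ = 0 := fun u => by
    have := inner_surfaceDeriv_add (a := fun _ => v) mdifferentiableAt_const hmd
      (by filter_upwards [hopen.mem_nhds hq] with q hq using hs1 q hq) u
    rwa [surfaceDeriv_const, inner_zero_left, add_zero] at this
  refine ⟨hsec, fun u => ?_, hs1 q hq, hd⟩
  have hJ : differential Y q (Complex.I * u : ℂ) = kahlerJ (Y q) (differential Y q u) :=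
    hY.commutes q u
  have h₁ := differential_section hY.smooth hsec (Complex.I * u)
  rw [hJ, kahlerJ, LinearMap.smul_apply, Submodule.coe_smul,
    differential_section hY.smooth hsec u, ← map_smul, ← sub_eq_zero, ← map_sub,
    Submodule.starProjection_apply_eq_zero_iff, Submodule.orthogonal_orthogonal,
    submodule_eq_span hsec.mem hsec.ne_zero] at h₁
  obtain ⟨c, hc⟩ := Submodule.mem_span_singleton.1 h₁
  have h₂ : c = 0 := by
    have := congrArg (fun w => ⟪v, w⟫_ℂ) hc
    simpa only [inner_smul_right, hs1 q hq, inner_sub_right, hd, mul_one, mul_zero,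
      sub_zero] using this
  rw [h₂, zero_smul] at hc
  exact (sub_eq_zero.1 hc.symm).symm

/-! ### Zeros of the differential -/

lemma eventually_nhdsNE_chart {p : M} {P : ℂ → Prop}
    (h : ∀ᶠ z in nhdsWithin (chartAt ℂ p p) {chartAt ℂ p p}ᶜ, P z) :
    ∀ᶠ q in nhdsWithin p {p}ᶜ, P (chartAt ℂ p q) := by
  have hp := mem_chart_source ℂ p
  rw [eventually_nhdsWithin_iff] at h ⊢
  filter_upwards [((chartAt ℂ p).continuousAt hp).eventually h,
    (chartAt ℂ p).open_source.mem_nhds hp] with q hq hq' hne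
  exact hq fun e => hne ((chartAt ℂ p).injOn hq' hp e)

/-- A surface has no isolated points, so limits along punctured neighbourhoods determine values. -/
lemma nhdsNE_neBot (p : M) : (nhdsWithin p {p}ᶜ).NeBot := by
  have hp := mem_chart_source ℂ p
  refine ⟨fun hbot => ?_⟩
  have h₁ : ∀ᶠ q in nhdsWithin p {p}ᶜ, False := by rw [hbot]; exact Filter.eventually_bot
  rw [eventually_nhdsWithin_iff] at h₁
  have h₂ : ∀ᶠ z in nhdsWithin (chartAt ℂ p p) {chartAt ℂ p p}ᶜ, False := by
    rw [eventually_nhdsWithin_iff]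
    filter_upwards [eventually_chart h₁,
      (chartAt ℂ p).open_target.mem_nhds ((chartAt ℂ p).map_source hp)] with z hz hz' hne
    refine hz fun e => hne ?_
    have e' : (chartAt ℂ p).symm z = p := e
    rw [Set.mem_singleton_iff, ← (chartAt ℂ p).right_inv hz', e']
  exact h₂.exists.elim fun _ h => h

lemma IsHolomorphicLift.eventually_chart {Y : M → CP3} {v : C4} {s : M → C4} {p : M}
    [IsManifold 𝓘(ℂ) ω M] (h : ∀ᶠ q in nhds p, IsHolomorphicLift Y v s q) :
    AnalyticAt ℂ (s ∘ (chartAt ℂ p).symm) (chartAt ℂ p p) ∧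
    ∀ᶠ q in nhds p, IsHolomorphicLift Y v s q ∧ q ∈ (chartAt ℂ p).source ∧ ∃ c : ℂ, c ≠ 0 ∧
      ∀ u, surfaceDeriv s q u = (c * u) • deriv (s ∘ (chartAt ℂ p).symm) (chartAt ℂ p q) := by
  refine ⟨analyticAt_of_commutes (h.mono fun q hq => ⟨hq.section_at.mdifferentiableAt,
    hq.commutes⟩), ?_⟩
  filter_upwards [h, (chartAt ℂ p).open_source.mem_nhds (mem_chart_source ℂ p)] with q hq hq'
  obtain ⟨c, hc, hd⟩ := hasDerivAt_of_commutes hq' hq.section_at.mdifferentiableAt hq.commutes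
  refine ⟨hq, hq', c⁻¹, inv_ne_zero hc, fun u => ?_⟩
  rw [hd.deriv, smul_smul, apply_eq_smul_of_commutes hq.commutes u]
  congr 1
  field_simp

/-- The differential of a holomorphic curve vanishes near `p`, and then the curve is constant near
`p`, or it does not vanish at the points near `p` that are different from `p`. -/
lemma differential_eventually_eq_zero_or [IsManifold 𝓘(ℂ) ω M] {Y : M → CP3}
    (hY : IsJCurve kahlerJ Y) (p : M) :
    (∀ᶠ q in nhds p, Y q = Y p) ∨
      ∀ᶠ q in nhdsWithin p {p}ᶜ, ∃ u : ℂ, differential Y q u ≠ 0 := by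
  obtain ⟨v, s, -, hs⟩ := exists_holomorphicLift hY p
  obtain ⟨hF, hs'⟩ := IsHolomorphicLift.eventually_chart hs
  have hp := mem_chart_source ℂ p
  rcases hF.deriv.eventually_eq_zero_or_eventually_ne_zero with h0 | h0
  · left
    have h₁ := h0.and (Complex.analyticAt_iff_eventually_differentiableAt.1 hF)
    obtain ⟨r, hr, hball⟩ := Metric.eventually_nhds_iff_ball.1 h₁
    have h₂ := ((chartAt ℂ p).continuousAt hp).eventually (Metric.ball_mem_nhds _ hr)
    filter_upwards [h₂, hs'] with q hq hq'
    have h₃ := Metric.isOpen_ball.is_const_of_deriv_eq_zero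
      (convex_ball (chartAt ℂ p p) r).isPreconnected
      (fun z hz => (hball z hz).2.differentiableWithinAt) (fun z hz => (hball z hz).1) hq
      (Metric.mem_ball_self hr)
    simp only [Function.comp_apply] at h₃
    rw [(chartAt ℂ p).left_inv hq'.2.1, (chartAt ℂ p).left_inv hp] at h₃
    apply Projectivization.submodule_injective
    have h₄ := hs.self_of_nhds.section_at
    rw [submodule_eq_span hq'.1.section_at.mem hq'.1.section_at.ne_zero,
      submodule_eq_span h₄.mem h₄.ne_zero, h₃]
  · right
    filter_upwards [eventually_nhdsNE_chart h0, nhdsWithin_le_nhds hs'] with q hq hq'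
    obtain ⟨h₁, -, c, hc, h₂⟩ := hq'
    refine ⟨1, fun e => ?_⟩
    rw [h₁.differential_eq_zero_iff hY.smooth, h₂, mul_one] at e
    exact (smul_ne_zero hc hq) e

/-- The zeros of the differential of a nonconstant holomorphic curve are isolated. -/
lemma eventually_differential_ne_zero [ConnectedSpace M] [IsManifold 𝓘(ℂ) ω M] {Y : M → CP3}
    (hY : IsJCurve kahlerJ Y) (p : M) :
    ∀ᶠ q in nhdsWithin p {p}ᶜ, ∃ u : ℂ, differential Y q u ≠ 0 := by
  -- The set where `Y` is locally constant is clopen. It is closed because, by the local dichotomy,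
  -- the differential is nonzero on a punctured neighbourhood of any point outside it.
  set A : Set M := {p | ∀ᶠ q in nhds p, Y q = Y p} with hA
  have hopen : IsOpen A := by
    refine isOpen_iff_eventually.2 fun p hp => ?_
    filter_upwards [hp.eventually_nhds, hp] with q hq hq'
    change ∀ᶠ r in nhds q, Y r = Y q
    rw [hq']
    exact hq
  have hclosed : IsClosed A := by
    refine ⟨isOpen_iff_eventually.2 fun p hp => ?_⟩
    have h₁ := (differential_eventually_eq_zero_or hY p).resolve_left hp
    rw [eventually_nhdsWithin_iff] at h₁
    filter_upwards [h₁] with q hq hqA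
    by_cases e : q = p
    · exact hp (e ▸ hqA)
    · obtain ⟨u, hu⟩ := hq e
      exact hu (differential_eq_zero_of_eventually_const hqA u)
  refine (differential_eventually_eq_zero_or hY p).resolve_left fun hp => ?_
  have huniv := (IsClopen.eq_univ ⟨hclosed, hopen⟩ ⟨p, hp⟩ : A = Set.univ)
  have hconst : IsLocallyConstant Y := (IsLocallyConstant.iff_eventually_eq Y).2 fun q => by
    have : q ∈ A := huniv.symm ▸ Set.mem_univ q
    exact this
  exact hY.nonconstant ⟨Y p, fun q => hconst.apply_eq_of_preconnectedSpace q p⟩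

/-! ### The tangent line of a contact curve -/

/-- A relation between continuous functions extends from a punctured neighbourhood. -/
lemma eventually_inner_eq_zero {a b : M → C4} {p : M} (ha : ContinuousAt a p)
    (hb : ContinuousAt b p) (h : ∀ᶠ q in nhdsWithin p {p}ᶜ, ⟪a q, b q⟫_ℂ = 0) :
    ∀ᶠ q in nhds p, ⟪a q, b q⟫_ℂ = 0 := by
  have := nhdsNE_neBot p
  have hp : ⟪a p, b p⟫_ℂ = 0 := by
    have h₁ : Filter.Tendsto (fun q => ⟪a q, b q⟫_ℂ) (nhdsWithin p {p}ᶜ) (nhds ⟪a p, b p⟫_ℂ) :=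
      (ha.inner hb).mono_left nhdsWithin_le_nhds
    exact tendsto_nhds_unique (h₁.congr' h) tendsto_const_nhds
  rw [eventually_nhdsWithin_iff] at h
  filter_upwards [h] with q hq
  by_cases e : q = p
  · rw [e, hp]
  · exact hq e

omit [ChartedSpace ℂ M] in
lemma continuousAt_jMul {a : M → C4} {p : M} (ha : ContinuousAt a p) :
    ContinuousAt (fun q => jMul (a q)) p :=
  jMulReal.continuous.continuousAt.comp ha

/-- Near every point there is a holomorphic frame `s, g` of the plane spanned by a holomorphic lift
`s` and its derivative, also at the zeros of the latter. -/
lemma exists_holomorphic_frame [ConnectedSpace M] [IsManifold 𝓘(ℂ) ω M] {Y : M → CP3}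
    (hY : IsContactCurve Y) (p : M) : ∃ (s g : M → C4) (b : C4),
      ContMDiffAt 𝓘(ℝ, ℂ) 𝓘(ℝ, C4) ∞ s p ∧ ContMDiffAt 𝓘(ℝ, ℂ) 𝓘(ℝ, C4) ∞ g p ∧
      (∀ u, surfaceDeriv g p u = u • b) ∧
      ∀ᶠ q in nhds p, IsSectionAt Y q s ∧ ⟪jMul (s q), g q⟫_ℂ = 0 ∧ (∀ c : ℂ, g q ≠ c • s q) ∧
        ∀ u, ∃ c : ℂ, surfaceDeriv s q u = c • g q := by
  obtain ⟨v, s, hsm, hs⟩ := exists_holomorphicLift hY.holomorphic p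
  obtain ⟨hF, hs'⟩ := IsHolomorphicLift.eventually_chart hs
  have hp := mem_chart_source ℂ p
  set F := s ∘ (chartAt ℂ p).symm
  have hne : ¬ ∀ᶠ z in nhds (chartAt ℂ p p), deriv F z = 0 := by
    intro h0
    have h₁ := ((chartAt ℂ p).continuousAt hp).eventually h0
    have h₂ := (eventually_differential_ne_zero hY.holomorphic p).and
      (nhdsWithin_le_nhds (h₁.and hs'))
    have := nhdsNE_neBot p
    obtain ⟨q, ⟨u, hu⟩, hq0, hq, -, c, -, hc⟩ := h₂.exists
    apply hu
    rw [hq.differential_eq_zero_iff hY.holomorphic.smooth, hc, hq0, smul_zero]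
  -- The zero of the derivative at `p` is divided out, leaving a holomorphic vector that does not
  -- vanish there.
  obtain ⟨n, G, hG, hG0, hFG⟩ := hF.deriv.exists_eventuallyEq_pow_smul_nonzero_iff.2 hne
  set g : M → C4 := fun q => G (chartAt ℂ p q) with hg
  have hgm := contMDiffAt_comp_chart hG
  have key : ∀ᶠ q in nhds p, IsHolomorphicLift Y v s q ∧ g q ≠ 0 ∧ ∃ c : ℂ,
      (q ≠ p → c ≠ 0) ∧ ∀ u, surfaceDeriv s q u = (c * u) • g q := by
    filter_upwards [hs', ((chartAt ℂ p).continuousAt hp).eventually hFG,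
      hgm.continuousAt.eventually_ne hG0] with q ⟨hq, hqs, c, hc, h₁⟩ h₂ h₃
    refine ⟨hq, h₃, c * (chartAt ℂ p q - chartAt ℂ p p) ^ n, fun e => ?_, fun u => ?_⟩
    · exact mul_ne_zero hc (pow_ne_zero _ (sub_ne_zero.2 fun e' =>
        e ((chartAt ℂ p).injOn hqs hp e')))
    · rw [h₁, h₂, smul_smul]
      congr 1
      ring
  -- Away from `p` this is `⟪v, ds⟫ = 0` divided by a nonzero factor, and it extends to `p` by
  -- continuity. With `⟪v, s⟫ = 1` it makes `g` independent of `s`.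
  have hvg : ∀ᶠ q in nhds p, ⟪v, g q⟫_ℂ = 0 := by
    refine eventually_inner_eq_zero continuousAt_const hgm.continuousAt ?_
    rw [eventually_nhdsWithin_iff]
    filter_upwards [key] with q ⟨hq, _, c, hc, h₁⟩ e
    have h₂ := hq.inner_deriv 1
    rw [h₁, mul_one, inner_smul_right] at h₂
    exact (mul_eq_zero.1 h₂).resolve_left (hc e)
  -- The contact condition `⟪s j, ds⟫ = 0` is divided by the same factor.
  have hωg : ∀ᶠ q in nhds p, ⟪jMul (s q), g q⟫_ℂ = 0 := by
    refine eventually_inner_eq_zero (continuousAt_jMul hsm.continuousAt) hgm.continuousAt ?_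
    rw [eventually_nhdsWithin_iff]
    filter_upwards [key] with q ⟨hq, _, c, hc, h₁⟩ e
    have h₂ := (mem_horizontalSpace_iff hq.section_at.mem hq.section_at.ne_zero).1
      (mem_horizontalSpace_iff_forall_contactSystem.1 (hY.integral q (1 : ℂ)))
    rw [inner_jMul_self_differential hY.holomorphic.smooth hq.section_at, h₁, mul_one,
      inner_smul_right] at h₂
    exact (mul_eq_zero.1 h₂).resolve_left (hc e)
  refine ⟨s, g, deriv G (chartAt ℂ p p), hsm, hgm, surfaceDeriv_comp_chart hG, ?_⟩
  filter_upwards [key, hvg, hωg] with q ⟨hq, hg0, c, _, h₁⟩ h₂ h₃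
  refine ⟨hq.section_at, h₃, fun k e => hg0 ?_, fun u => ⟨c * u, h₁ u⟩⟩
  rw [e, inner_smul_right, hq.inner_eq, mul_one] at h₂
  rw [e, h₂, zero_smul]

lemma contMDiffAt_inner_div {s g : M → C4} {p : M}
    (hs : ContMDiffAt 𝓘(ℝ, ℂ) 𝓘(ℝ, C4) ∞ s p) (hg : ContMDiffAt 𝓘(ℝ, ℂ) 𝓘(ℝ, C4) ∞ g p)
    (h0 : s p ≠ 0) :
    ContMDiffAt 𝓘(ℝ, ℂ) 𝓘(ℝ, ℂ) ∞ (fun q => ⟪s q, g q⟫_ℂ / ⟪s q, s q⟫_ℂ) p := by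
  have h₁ : ContDiffAt ℝ ∞ (fun w : C4 × C4 => ⟪w.1, w.2⟫_ℂ) (s p, g p) :=
    ContDiffAt.inner ℂ contDiffAt_fst contDiffAt_snd
  have h₂ : ContDiffAt ℝ ∞ (fun w : C4 × C4 => ⟪w.1, w.1⟫_ℂ) (s p, g p) :=
    ContDiffAt.inner ℂ contDiffAt_fst contDiffAt_fst
  have h₃ : ContDiffAt ℝ ∞ (fun w : C4 × C4 => ⟪w.1, w.2⟫_ℂ / ⟪w.1, w.1⟫_ℂ) (s p, g p) := by
    simp only [div_eq_mul_inv]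
    exact h₁.mul (h₂.inv (inner_self_ne_zero.2 h0))
  exact h₃.comp_contMDiffAt (f := fun q => (s q, g q)) (hs.prodMk_space hg)

lemma contMDiffAt_smul {s : M → C4} {c : M → ℂ} {p : M}
    (hs : ContMDiffAt 𝓘(ℝ, ℂ) 𝓘(ℝ, C4) ∞ s p) (hc : ContMDiffAt 𝓘(ℝ, ℂ) 𝓘(ℝ, ℂ) ∞ c p) :
    ContMDiffAt 𝓘(ℝ, ℂ) 𝓘(ℝ, C4) ∞ (fun q => c q • s q) p := by
  have h₁ : ContDiff ℝ ∞ (fun w : ℂ × C4 => w.1 • w.2) := contDiff_fst.smul contDiff_snd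
  exact h₁.comp_contMDiffAt (f := fun q => (c q, s q)) (hc.prodMk_space hs)

lemma exists_surfaceDeriv_sub_smul {s g : M → C4} {c : M → ℂ} {p : M}
    (hs : MDifferentiableAt 𝓘(ℝ, ℂ) 𝓘(ℝ, C4) s p) (hg : MDifferentiableAt 𝓘(ℝ, ℂ) 𝓘(ℝ, C4) g p)
    (hc : MDifferentiableAt 𝓘(ℝ, ℂ) 𝓘(ℝ, ℂ) c p)
    (he : MDifferentiableAt 𝓘(ℝ, ℂ) 𝓘(ℝ, C4) (fun q => g q - c q • s q) p) (u : ℂ) :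
    ∃ k : ℂ, surfaceDeriv (fun q => g q - c q • s q) p u =
      surfaceDeriv g p u - (c p • surfaceDeriv s p u + k • s p) := by
  have hd := (hasFDerivAt_chart hg).sub ((hasFDerivAt_chart hc).smul (hasFDerivAt_chart hs))
  refine ⟨surfaceDeriv c p u, ?_⟩
  rw [surfaceDeriv_eq he hd]
  simp
/-- A local section of the line that completes a contact curve to a map to the flag manifold. -/
lemma exists_local_partner [ConnectedSpace M] [IsManifold 𝓘(ℂ) ω M] {Y : M → CP3}
    (hY : IsContactCurve Y) (p : M) : ∃ x : M → C4,
      ContMDiffAt 𝓘(ℝ, ℂ) 𝓘(ℝ, C4) ∞ x p ∧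
      (∀ u, ⟪jMul (x p), surfaceDeriv x p (Complex.I * u)⟫_ℂ =
        -(Complex.I * ⟪jMul (x p), surfaceDeriv x p u⟫_ℂ)) ∧
      ∀ᶠ q in nhds p, x q ≠ 0 ∧ (∀ w ∈ (Y q).submodule, QuatOrthogonal w (x q)) ∧
        ∀ m : CP3, LineOrthogonal (Y q) m → x q ∈ m.submodule → ∀ u : ℂ,
          differential Y q u ∈ tangentLine (Y q) m := by
  obtain ⟨s, g, b, hs, hg, hb, h⟩ := exists_holomorphic_frame hY p
  set c : M → ℂ := fun q => ⟪s q, g q⟫_ℂ / ⟪s q, s q⟫_ℂ with hc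
  -- This is Gram–Schmidt: `e` is the part of `g` orthogonal to `s`, so `e` spans the tangent
  -- direction of `Y` and the partner is `e j`.
  set e : M → C4 := fun q => g q - c q • s q with he
  have hsp := h.self_of_nhds.1
  have hcm : ContMDiffAt 𝓘(ℝ, ℂ) 𝓘(ℝ, ℂ) ∞ c p := contMDiffAt_inner_div hs hg hsp.ne_zero
  have hem : ContMDiffAt 𝓘(ℝ, ℂ) 𝓘(ℝ, C4) ∞ e p := hg.sub (contMDiffAt_smul hs hcm)
  have hse : ∀ q, s q ≠ 0 → ⟪s q, e q⟫_ℂ = 0 := fun q hq => by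
    rw [he, inner_sub_right, inner_smul_right, div_mul_cancel₀ _ (inner_self_ne_zero.2 hq), sub_self]
  have hωse : ∀ q, ⟪jMul (s q), g q⟫_ℂ = 0 → ⟪jMul (s q), e q⟫_ℂ = 0 := fun q hq => by
    rw [he, inner_sub_right, hq, inner_smul_right, inner_jMul_self]; simp
  have hωeg : ∀ q, ⟪jMul (s q), g q⟫_ℂ = 0 → ⟪jMul (e q), g q⟫_ℂ = 0 := fun q hq => by
    have : g q = e q + c q • s q := (sub_add_cancel _ _).symm
    rw [this, inner_add_right, inner_smul_right, inner_jMul_self, inner_jMul_swap, hωse q hq]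
    simp
  refine ⟨fun q => jMul (e q), contMDiffAt_jMul hem, ?_, ?_⟩
  · obtain ⟨-, hω, -, hds⟩ := h.self_of_nhds
    have h₁ : ⟪s p, jMul (e p)⟫_ℂ = 0 := by
      rw [inner_jMul_right, neg_eq_zero]
      exact inner_eq_zero_symm.1 (hωse p hω)
    have h₂ : ∀ u, ⟪surfaceDeriv s p u, jMul (e p)⟫_ℂ = 0 := fun u => by
      obtain ⟨k, hk⟩ := hds u
      rw [hk, inner_smul_left, inner_eq_zero_symm.1 (hωeg p hω), mul_zero]
    -- Removing one `j` turns the left side into `⟪de, e j⟫`. In `de = dg - c ds - dc s` the last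
    -- two terms are orthogonal to `e j`, and `dg(u) = u b` stands in the conjugate linear slot.
    have h₃ : ∀ u, ⟪jMul (jMul (e p)), surfaceDeriv (fun q => jMul (e q)) p u⟫_ℂ =
        starRingEnd ℂ u * ⟪b, jMul (e p)⟫_ℂ := fun u => by
      obtain ⟨k, hk⟩ := exists_surfaceDeriv_sub_smul (hs.mdifferentiableAt (by simp))
        (hg.mdifferentiableAt (by simp)) (hcm.mdifferentiableAt (by simp))
        (hem.mdifferentiableAt (by simp)) u
      rw [surfaceDeriv_jMul (hem.mdifferentiableAt (by simp)), inner_jMul_jMul, hk, hb,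
        inner_sub_left, inner_add_left, inner_smul_left, inner_smul_left, inner_smul_left, h₁, h₂]
      ring
    intro u
    rw [h₃, h₃, map_mul, Complex.conj_I]
    ring
  · filter_upwards [h] with q ⟨hsq, hω, hgs, hds⟩
    have he0 : e q ≠ 0 := fun h0 => hgs (c q) (sub_eq_zero.1 h0)
    have hq : QuatOrthogonal (s q) (jMul (e q)) := by
      constructor
      · rw [inner_jMul_right, neg_eq_zero]
        exact inner_eq_zero_symm.1 (hωse q hω)
      · rw [inner_jMul_jMul]
        exact inner_eq_zero_symm.1 (hse q hsq.ne_zero)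
    refine ⟨jMul_ne_zero he0, fun w hw => ?_, fun m hm hxm u => ?_⟩
    · obtain ⟨k, rfl⟩ := Submodule.mem_span_singleton.1
        (submodule_eq_span hsq.mem hsq.ne_zero ▸ hw)
      constructor
      · rw [inner_smul_left, hq.1, mul_zero]
      · rw [map_smulₛₗ, inner_smul_left, hq.2, mul_zero]
    · rw [mem_tangentLine_iff hsq.mem hsq.ne_zero hxm (jMul_ne_zero he0) hm]
      refine ⟨mem_horizontalSpace_iff_forall_contactSystem.1 (hY.integral q u), ?_⟩
      obtain ⟨k, hk⟩ := hds u
      rw [inner_differential_section hY.holomorphic.smooth hsq hq.1, hk, inner_smul_right,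
        hωeg q hω, mul_zero]

/-! ### Uniqueness of the line bundles -/

lemma SmoothMap.eq_of_eventually_eq {X₁ X₂ : M → CP3} (h₁ : SmoothMap X₁) (h₂ : SmoothMap X₂)
    {p : M} (h : ∀ᶠ q in nhdsWithin p {p}ᶜ, X₁ q = X₂ q) : X₁ p = X₂ p := by
  have := nhdsNE_neBot p
  apply Projectivization.submodule_injective
  rw [← Submodule.starProjection_inj]
  have t₁ : Filter.Tendsto (fun q => (X₁ q).submodule.starProjection) (nhdsWithin p {p}ᶜ)
      (nhds (X₁ p).submodule.starProjection) :=
    (h₁ p).continuousAt.tendsto.mono_left nhdsWithin_le_nhds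
  have t₂ : Filter.Tendsto (fun q => (X₂ q).submodule.starProjection) (nhdsWithin p {p}ᶜ)
      (nhds (X₂ p).submodule.starProjection) :=
    (h₂ p).continuousAt.tendsto.mono_left nhdsWithin_le_nhds
  exact tendsto_nhds_unique (t₁.congr' (h.mono fun q hq => by rw [hq])) t₂

/-- A common nonzero vector forces two complex lines to coincide. Agreement on punctured
neighbourhoods extends to the centre by continuity of the associated maps to `ℂP³`. -/
lemma IsHorizontalLineBundle.eq_of_eventually {X : M → CP3} (hX : SmoothMap X)
    {L₁ L₂ : ∀ p, Submodule ℂ (TangentAt (X p))} (h₁ : IsHorizontalLineBundle X L₁)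
    (h₂ : IsHorizontalLineBundle X L₂)
    (h : ∀ p, ∀ᶠ q in nhdsWithin p {p}ᶜ, ∃ A ≠ 0, A ∈ L₁ q ∧ A ∈ L₂ q) : L₁ = L₂ := by
  obtain ⟨Y₁, hY₁, rfl⟩ := h₁.exists_flagPair hX
  obtain ⟨Y₂, hY₂, rfl⟩ := h₂.exists_flagPair hX
  funext p
  have : Y₁ p = Y₂ p := by
    refine hY₁.smooth₂.eq_of_eventually_eq hY₂.smooth₂ ?_
    filter_upwards [h p] with q ⟨A, hA, hA₁, hA₂⟩
    apply eq_of_tangentLine_eq (hY₁.orthogonal q) (hY₂.orthogonal q)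
    rw [eq_span_of_finrank_eq_one (h₁.rank_one q) hA hA₁,
      eq_span_of_finrank_eq_one (h₂.rank_one q) hA hA₂]
  simp only [this]

/-! ### The correspondence -/

/-- `X` is a null-torsion curve, `Y` is a contact curve, and they are the components of a map to
the flag manifold that is the lift of both of them. -/
structure IsCorrespondingPair (X Y : M → CP3) : Prop where
  flagPair : IsFlagPair X Y
  nullTorsion : IsNullTorsionCurve X
  contact : IsContactCurve Y
  tangentLine₁ : IsTangentLine X fun p => tangentLine (X p) (Y p)
  tangentLine₂ : IsContactTangentLine Y fun p => tangentLine (Y p) (X p)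

lemma IsNullTorsionCurve.exists_correspondingPair {X : M → CP3} (hX : IsNullTorsionCurve X) :
    ∃ Y, IsCorrespondingPair X Y := by
  obtain ⟨L, hL, hII⟩ := hX.null_torsion
  obtain ⟨Y, hXY, rfl⟩ :=
    hL.toIsHorizontalLineBundle.exists_flagPair hX.pseudoholomorphic.smooth
  have hYX := hXY.isContactTangentLine hL hII
  exact ⟨Y, hXY, hX, hXY.isContactCurve hX.pseudoholomorphic hX.not_vertical hL hYX, hL, hYX⟩

variable [ConnectedSpace M] [IsManifold 𝓘(ℂ) ω M]

lemma IsContactTangentLine.unique {Y : M → CP3} (hY : IsContactCurve Y)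
    {L₁ L₂ : ∀ p, Submodule ℂ (TangentAt (Y p))} (h₁ : IsContactTangentLine Y L₁)
    (h₂ : IsContactTangentLine Y L₂) : L₁ = L₂ := by
  refine h₁.toIsHorizontalLineBundle.eq_of_eventually hY.holomorphic.smooth
    h₂.toIsHorizontalLineBundle fun p => ?_
  filter_upwards [eventually_differential_ne_zero hY.holomorphic p] with q ⟨u, hu⟩
  exact ⟨_, hu, h₁.differential_mem q u, h₂.differential_mem q u⟩

/-- The zeros of `𝐈₁` are those of `dY`, hence isolated, although `X` itself is not holomorphic for
the Kähler structure in general. -/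
lemma IsCorrespondingPair.unique_tangentLine {X Y : M → CP3} (h : IsCorrespondingPair X Y)
    {L : ∀ p, Submodule ℂ (TangentAt (X p))} (hL : IsTangentLine X L) :
    L = fun p => tangentLine (X p) (Y p) := by
  refine hL.toIsHorizontalLineBundle.eq_of_eventually h.flagPair.smooth₁
    h.tangentLine₁.toIsHorizontalLineBundle fun p => ?_
  filter_upwards [eventually_differential_ne_zero h.contact.holomorphic p] with q ⟨u, hu⟩
  exact ⟨formI₁ X q u, fun e => hu ((h.flagPair.formI₁_eq_zero_iff (h.tangentLine₁.formI₁_mem q u)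
    (h.tangentLine₂.differential_mem q u)).1 e), hL.formI₁_mem q u,
    h.tangentLine₁.formI₁_mem q u⟩

lemma IsCorrespondingPair.unique₂ {X Y Y' : M → CP3} (h : IsCorrespondingPair X Y)
    (h' : IsCorrespondingPair X Y') : Y = Y' :=
  funext fun p => eq_of_tangentLine_eq (h.flagPair.orthogonal p) (h'.flagPair.orthogonal p)
    (congrFun (h'.unique_tangentLine h.tangentLine₁) p)

lemma IsCorrespondingPair.unique₁ {X X' Y : M → CP3} (h : IsCorrespondingPair X Y)
    (h' : IsCorrespondingPair X' Y) : X = X' :=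
  funext fun p => eq_of_tangentLine_eq (h.flagPair.symm.orthogonal p)
    (h'.flagPair.symm.orthogonal p)
    (congrFun (h.tangentLine₂.unique h.contact h'.tangentLine₂) p)

/-- The local partners are glued by defining `X p` through the value at `p` of the partner chosen at
`p`. Smoothness requires that this partner remains a section of `X` near `p`. -/
lemma IsContactCurve.exists_correspondingPair {Y : M → CP3} (hY : IsContactCurve Y) :
    ∃ X, IsCorrespondingPair X Y := by
  choose x hxs hx3 hx using fun p => exists_local_partner hY p
  choose X hX using fun p => exists_submodule_eq_span (hx p).self_of_nhds.1
  have horth : ∀ (q : M) (v : C4) (m : CP3), m.submodule = Submodule.span ℂ {v} →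
      (∀ w ∈ (Y q).submodule, QuatOrthogonal w v) → LineOrthogonal (Y q) m := by
    intro q v m hm h w hw a ha
    obtain ⟨c, rfl⟩ := Submodule.mem_span_singleton.1 (hm ▸ ha)
    exact ⟨by rw [inner_smul_right, (h w hw).1, mul_zero],
      by rw [inner_smul_right, (h w hw).2, mul_zero]⟩
  have hYX : ∀ p, LineOrthogonal (Y p) (X p) := fun p =>
    horth p _ _ (hX p) (hx p).self_of_nhds.2.1
  have hself : ∀ q, x q q ∈ (X q).submodule := fun q =>
    hX q ▸ Submodule.mem_span_singleton_self _
  have hmem : ∀ p (u : ℂ), differential Y p u ∈ tangentLine (Y p) (X p) := fun p u =>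
    (hx p).self_of_nhds.2.2 (X p) (hYX p) (hself p) u
  -- At a point `q ≠ p` near `p` the differential is nonzero, so it spans `Hom(Y, m j)` for the
  -- lines `m` of both partners, and these lines agree.
  have hnear : ∀ p, ∀ᶠ q in nhds p, x p q ∈ (X q).submodule := by
    intro p
    have h₁ := eventually_differential_ne_zero hY.holomorphic p
    rw [eventually_nhdsWithin_iff] at h₁
    filter_upwards [h₁, hx p] with q hq ⟨hx0, hxo, hxt⟩
    by_cases e : q = p
    · rw [e]
      exact hself p
    · obtain ⟨u, hu⟩ := hq e
      obtain ⟨m, hm⟩ := exists_submodule_eq_span hx0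
      have hxm : x p q ∈ m.submodule := hm ▸ Submodule.mem_span_singleton_self _
      have hmo := horth q _ m hm hxo
      have : m = X q := by
        apply eq_of_tangentLine_eq hmo (hYX q)
        rw [eq_span_of_finrank_eq_one (finrank_tangentLine hmo) hu (hxt m hmo hxm u),
          eq_span_of_finrank_eq_one (finrank_tangentLine (hYX q)) hu (hmem q u)]
      exact this ▸ hxm
  have hsec : ∀ p, IsSectionAt X p (x p) := fun p =>
    ⟨(hxs p).mdifferentiableAt (by simp), (hx p).self_of_nhds.1, hnear p⟩
  have hflag : IsFlagPair X Y :=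
    { smooth₁ := SmoothFamily.of_section fun p => ⟨x p, hxs p, (hsec p).ne_zero, by
        filter_upwards [hnear p, hx p] with q hq hq' using submodule_eq_span hq hq'.1⟩
      smooth₂ := hY.holomorphic.smooth
      orthogonal := fun p => (hYX p).symm }
  have hcontact : IsContactTangentLine Y fun p => tangentLine (Y p) (X p) :=
    { toIsHorizontalLineBundle := hflag.symm.isHorizontalLineBundle
      differential_mem := hmem }
  have hY0 : ∃ (p : M) (u : ℂ), differential Y p u ≠ 0 := by
    obtain ⟨p⟩ := (inferInstance : Nonempty M)
    have := nhdsNE_neBot p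
    obtain ⟨q, hq⟩ := (eventually_differential_ne_zero hY.holomorphic p).exists
    exact ⟨q, hq⟩
  exact ⟨X, hflag, hflag.isNullTorsionCurve hY hY0 hcontact fun p => ⟨x p, hsec p, hx3 p⟩, hY,
    hflag.isTangentLine hcontact, hcontact⟩

/-- The correspondence of null-torsion curves and contact curves. -/
def nullTorsionEquivContact :
    {X : M → CP3 // IsNullTorsionCurve X} ≃ {Y : M → CP3 // IsContactCurve Y} where
  toFun X := ⟨_, X.2.exists_correspondingPair.choose_spec.contact⟩
  invFun Y := ⟨_, Y.2.exists_correspondingPair.choose_spec.nullTorsion⟩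
  left_inv X := Subtype.ext (IsCorrespondingPair.unique₁
    (IsContactCurve.exists_correspondingPair
      X.2.exists_correspondingPair.choose_spec.contact).choose_spec
    X.2.exists_correspondingPair.choose_spec)
  right_inv Y := Subtype.ext (IsCorrespondingPair.unique₂
    (IsNullTorsionCurve.exists_correspondingPair
      Y.2.exists_correspondingPair.choose_spec.nullTorsion).choose_spec
    Y.2.exists_correspondingPair.choose_spec)

lemma isCorrespondingPair_nullTorsionEquivContact (X : {X : M → CP3 // IsNullTorsionCurve X}) :
    IsCorrespondingPair X.1 (nullTorsionEquivContact X).1 :=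
  X.2.exists_correspondingPair.choose_spec

lemma isCorrespondingPair_nullTorsionEquivContact_symm
    (Y : {Y : M → CP3 // IsContactCurve Y}) :
    IsCorrespondingPair (nullTorsionEquivContact.symm Y).1 Y.1 :=
  Y.2.exists_correspondingPair.choose_spec

end NearlyKahler

end

theorem mainTheorem1 {M : Type*} [TopologicalSpace M] [T2Space M] [ConnectedSpace M]
    [ChartedSpace ℂ M] [IsManifold 𝓘(ℂ) ω M] :
    (∀ X : M → NearlyKahler.CP3, NearlyKahler.IsNullTorsionCurve X →
      ∃! L, NearlyKahler.IsTangentLine X L) ∧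
    (∀ Y : M → NearlyKahler.CP3, NearlyKahler.IsContactCurve Y →
      ∃! L, NearlyKahler.IsContactTangentLine Y L) ∧
    ∃ Φ : {X : M → NearlyKahler.CP3 // NearlyKahler.IsNullTorsionCurve X} ≃
        {Y : M → NearlyKahler.CP3 // NearlyKahler.IsContactCurve Y},
      (∀ X L, NearlyKahler.IsTangentLine X.1 L →
        ∃ F : M → NearlyKahler.Flag, NearlyKahler.IsNormalLift X.1 L F ∧
          ∀ p, (Φ X).1 p = (F p).proj₂) ∧
      (∀ Y L, NearlyKahler.IsContactTangentLine Y.1 L →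
        ∃ F : M → NearlyKahler.Flag, NearlyKahler.IsContactLift Y.1 L F ∧
          ∀ p, (Φ.symm Y).1 p = (F p).proj₁) := by
  refine ⟨fun X hX => ?_, fun Y hY => ?_, NearlyKahler.nullTorsionEquivContact,
    fun X L hL => ?_, fun Y L hL => ?_⟩
  · obtain ⟨Y, hXY⟩ := hX.exists_correspondingPair
    exact ⟨_, hXY.tangentLine₁, fun L hL => hXY.unique_tangentLine hL⟩
  · obtain ⟨X, hXY⟩ := hY.exists_correspondingPair
    exact ⟨_, hXY.tangentLine₂, fun L hL => hL.unique hY hXY.tangentLine₂⟩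
  · have h := NearlyKahler.isCorrespondingPair_nullTorsionEquivContact X
    -- Uniqueness replaces an arbitrary `L` by `Hom(X, Y j)`, whose normal line is `Y` itself; the
    -- lift is then the flag pair.
    obtain rfl := h.unique_tangentLine hL
    exact ⟨fun p => ⟨(X.1 p, _), h.flagPair.orthogonal p⟩, fun p => ⟨rfl,
      (NearlyKahler.tensorLine_normalSpace (h.flagPair.orthogonal p)).symm⟩, fun p => rfl⟩
  · have h := NearlyKahler.isCorrespondingPair_nullTorsionEquivContact_symm Y
    obtain rfl := hL.unique Y.2 h.tangentLine₂
    exact ⟨fun p => ⟨(_, Y.1 p), h.flagPair.orthogonal p⟩, fun p =>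
      ⟨(NearlyKahler.tensorLine_normalSpace (h.flagPair.symm.orthogonal p)).symm, rfl⟩,
      fun p => rfl⟩
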